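/- A metric measure space $(X,d,\mu)$ is a metric space with a Borel measure that is finite on bounded sets; $B(x,r)$ is the closed ball and $V(x,r)=\mu(B(x,r))$. It is *locally doubling* if for every $r>0$ there is $C_r$ with $V(x,2r)\le C_rV(x,r)$ for all $x$. For $h>0$ put $|\nabla f|_h(x)=\sup\{|f(y)-f(x)|: d(x,y)\le h\}$, and let $L^\infty(A)$ be the set of bounded measurable functions vanishing outside $A$. For $1\le p\le\infty$ and $\varphi:[0,\infty)\to[0,\infty)$ nondecreasing, $X$ satisfies $(S^p_\varphi)$ at scale $h$ if there are $C,C'>0$ with $$\|f\|_p\le C\,\varphi(C'|\Omega|)\,\||\nabla f|_h\|_p\qquad(\Omega\subset X\text{ compact},\ f\in L^\infty(\Omega)),$$ where $|\Omega|=\mu(\Omega)$. Let $J_{X,h,p}(A)=\sup_{f\in L^\infty(A)}\|f\|_p/\||\nabla f|_h\|_p\in[0,\infty]$ (with $0/0=0$ and $a/0=\infty$ for $a>0$), $j_{X,h,p}(v)=\sup_{\mu(A)\le v}J_{X,h,p}(A)$ over measurable $A$, and $J^b_{X,h,p}(t)=\sup_{x}J_{X,h,p}(B(x,t))$. Write $f\preceq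 g$ if there is $C>0$ with $f(t)=O(g(Ct))$ as $t\to\infty$. Let $(X,d_X,\mu)$ and $(Y,d_Y,\lambda)$ be locally doubling. A *large-scale foliation* of $X$ by $Y$ is a partition $X=\bigsqcup_{z\in Z}Y_z$ into measurable leaves, with a measure $\nu$ on $Z$ and, for $\nu$-almost every $z$, a measure $\lambda_z$ on $Y_z$, a number $\alpha_z>0$ and a map $h_z:Y\to Y_z$, such that: (1) $\int_X f\,d\mu=\int_Z\int_{Y_z}f\,d\lambda_z\,d\nu(z)$ for all continuous compactly supported $f$; (2) the $h_z$ are large-scale equivalences $(Y,d_Y,\lambda)\to(Y_z,d_X,\alpha_z\lambda_z)$ uniformly in $z$, i.e. with constants independent of $z$: for every $R$ there is $R'$ such that $d_Y(y,y')\le R$ implies $d_X(h_zy,h_zy')\le R'$ and $d_X(h_zy,h_zy')\le R$ implies $d_Y(y,y')\le R'$; every point of $Y_z$ is within $C$ of $h_z(Y)$; and for every large enough $r$ there is $C_r\ge 1$ with $C_r^{-1}V_Y(y,r)\le\alpha_z\lambda_z(B(h_zy,r))\le C_rV_Y(y,r)$ for all $y\in Y$. It is *normal* if moreover there is $C\ge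 1$ such that $C^{-1}\le\mu(B(x,1))\le C$ for all $x\in X$ and, for almost every $z$, $C^{-1}\le\lambda_z(B(x,1))\le C$ for all $x\in Y_z$. Its *compression* is $\rho(t)=\inf_z\inf_{d_Y(y,y')\ge t}d_X(h_zy,h_zy')\in[0,\infty]$ (over those $z$ for which $h_z$ is given; $\rho(t)=\infty$ if there are no such pairs $y,y'$, and $B(x,\infty)=X$). **Theorem.** Let $X$ and $Y$ be locally doubling metric measure spaces, $X$ locally compact and $Y$ complete, with $X$ large-scale foliated by $Y$, and let $h>0$. There is $h_0>0$ such that for all $h'\ge h_0$ and all $1\le p\le\infty$: (i) Assume the foliation is normal, and let $\varphi:[0,\infty)\to[0,\infty)$ be nondecreasing. If $Y$ satisfies $(S^p_\varphi)$ at scale $h$, then for every $v_0>0$ there are $C,C'>0$ such that the inequality of $(S^p_\varphi)$ at scale $h'$ holds for all compact $\Omega\subset X$ with $|\Omega|\ge v_0$ and all $f\in L^\infty(\Omega)$; and if $\varphi(0)>0$, then $X$ satisfies $(S^p_\varphi)$ at scale $h'$, for all compact $\Omega$. (ii) If the foliation is normal, then $j_{X,h',p}\preceq j_{Y,h,p}$.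 (iii) For every $0<c<1/2$, $\ J^b_{X,h',p}\circ(c\rho)\preceq J^b_{Y,h,p}$. This does not require the foliation to be normal. -/

import Mathlib

open MeasureTheory Filter
open scoped NNReal ENNReal

/-- The measure of every bounded set is finite: the standing requirement on the measure of a
metric measure space. -/
def FiniteOnBounded {X : Type*} [MetricSpace X] [MeasurableSpace X] (μ : Measure X) : Prop :=
  ∀ s : Set X, Bornology.IsBounded s → μ s < ∞

/-- The locally doubling property: for every `r > 0` there is `C_r` with
`V(x, 2r) ≤ C_r V(x, r)` for all `x`, where `V(x, r)` is the volume of the closed ball. -/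
def LocallyDoubling {X : Type*} [MetricSpace X] [MeasurableSpace X] (μ : Measure X) : Prop :=
  ∀ r : ℝ, 0 < r → ∃ C : ℝ≥0, ∀ x : X,
    μ (Metric.closedBall x (2 * r)) ≤ C * μ (Metric.closedBall x r)

/-- The local norm of the gradient at scale `h`:
`|∇f|_h (x) = sup {|f y - f x| : d(x, y) ≤ h}`, as an extended nonnegative number. -/
noncomputable def gradAt {X : Type*} [MetricSpace X] (h : ℝ) (f : X → ℝ) (x : X) : ℝ≥0∞ :=
  ⨆ y : X, ⨆ _ : dist x y ≤ h, ENNReal.ofReal |f y - f x|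

/-- `L^∞(A)`: bounded measurable functions on `X` that vanish outside `A`. (The gradient at scale
`h` is a pointwise supremum, so these are genuine functions, not classes.) -/
def BoundedSupportedIn {X : Type*} [MeasurableSpace X] (A : Set X) : Set (X → ℝ) :=
  {f | Measurable f ∧ (∃ M : ℝ, ∀ x, |f x| ≤ M) ∧ Function.support f ⊆ A}

/-- The Sobolev inequality `(S^p_φ)` at scale `h`, restricted to compact sets `Ω` of measure at
least `v₀`: there are `C, C' > 0` with `‖f‖_p ≤ C φ(C'|Ω|) ‖|∇f|_h‖_p` for all compact `Ω` with
`|Ω| ≥ v₀` and all `f ∈ L^∞(Ω)`. -/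
def SobolevFrom {X : Type*} [MetricSpace X] [MeasurableSpace X] (μ : Measure X)
    (v₀ : ℝ≥0) (h : ℝ) (p : ℝ≥0∞) (φ : ℝ≥0 → ℝ≥0) : Prop :=
  ∃ C C' : ℝ≥0, 0 < C ∧ 0 < C' ∧
    ∀ Ω : Set X, IsCompact Ω → (v₀ : ℝ≥0∞) ≤ μ Ω → ∀ f ∈ BoundedSupportedIn Ω,
      eLpNorm f p μ ≤ C * φ (C' * (μ Ω).toNNReal) * eLpNorm (gradAt h f) p μ

/-- The Sobolev inequality `(S^p_φ)` at scale `h` (all compact sets `Ω`). -/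
def Sobolev {X : Type*} [MetricSpace X] [MeasurableSpace X] (μ : Measure X)
    (h : ℝ) (p : ℝ≥0∞) (φ : ℝ≥0 → ℝ≥0) : Prop :=
  SobolevFrom μ 0 h p φ

/-- `J_{h,p}(A) = sup_{f ∈ L^∞(A)} ‖f‖_p / ‖|∇f|_h‖_p`. Division is that of `[0, ∞]`:
a nonzero `f` with zero gradient gives the value `∞`, and `f = 0` contributes `0`. -/
noncomputable def Jset {X : Type*} [MetricSpace X] [MeasurableSpace X] (μ : Measure X)
    (h : ℝ) (p : ℝ≥0∞) (A : Set X) : ℝ≥0∞ :=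
  ⨆ f ∈ BoundedSupportedIn A, eLpNorm f p μ / eLpNorm (gradAt h f) p μ

/-- The `L^p`-isoperimetric profile `j_{X,h,p}(v) = sup_{|A| ≤ v} J_{h,p}(A)`. -/
noncomputable def isoProfile {X : Type*} [MetricSpace X] [MeasurableSpace X] (μ : Measure X)
    (h : ℝ) (p : ℝ≥0∞) (v : ℝ) : ℝ≥0∞ :=
  ⨆ A : Set X, ⨆ _ : MeasurableSet A ∧ μ A ≤ ENNReal.ofReal v, Jset μ h p A

/-- The `L^p`-isoperimetric profile inside balls `J^b_{X,h,p}(t) = sup_x J_{h,p}(B(x,t))`, with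
closed balls. The radius may be `∞`, in which case the ball is the whole space. -/
noncomputable def isoProfileBalls {X : Type*} [MetricSpace X] [MeasurableSpace X] (μ : Measure X)
    (h : ℝ) (p : ℝ≥0∞) (t : ℝ≥0∞) : ℝ≥0∞ :=
  ⨆ x : X, Jset μ h p {y | edist y x ≤ t}

/-- `f ⪯ g`: there is `C > 0` with `f(t) = O(g(Ct))` as `t → ∞`. -/
def AsympLE (f g : ℝ → ℝ≥0∞) : Prop :=
  ∃ C : ℝ, 0 < C ∧ ∃ K : ℝ≥0, ∀ᶠ t in atTop, f t ≤ K * g (C * t)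

/-- A family of maps `F i : Y → X`, `i ∈ S`, is a uniform family of large-scale equivalences from
`(Y, lam)` onto the subspaces `L i` of `X`, equipped with the induced metric and the measure
`m i` (a measure on `X` carried by `L i`):

* distances in the source go to infinity if and only if distances in the target do, uniformly
  in `i` (written with control constants instead of sequences);
* there is one `C` such that the `C`-neighbourhood of the image of `F i` is `L i`;
* for every large enough `r`, the volumes of the balls of radius `r` about `y` and `F i y` are
  comparable, uniformly in `y` and `i`. -/
structure UniformLargeScaleEquiv {ι X Y : Type*} [MetricSpace X] [MeasurableSpace X]
    [MetricSpace Y] [MeasurableSpace Y] (lam : Measure Y) (S : Set ι) (L : ι → Set X)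
    (m : ι → Measure X) (F : ι → Y → X) : Prop where
  mapsTo : ∀ i ∈ S, ∀ y, F i y ∈ L i
  upper : ∀ R : ℝ, ∃ R' : ℝ, ∀ i ∈ S, ∀ y y' : Y, dist y y' ≤ R → dist (F i y) (F i y') ≤ R'
  lower : ∀ R : ℝ, ∃ R' : ℝ, ∀ i ∈ S, ∀ y y' : Y, dist (F i y) (F i y') ≤ R → dist y y' ≤ R'
  almostOnto : ∃ C : ℝ, ∀ i ∈ S, ∀ x ∈ L i, ∃ y : Y, dist x (F i y) ≤ C
  volume : ∃ r₀ : ℝ, ∀ r : ℝ, r₀ ≤ r → ∃ C : ℝ≥0, ∀ i ∈ S, ∀ y : Y,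
    lam (Metric.closedBall y r) ≤ C * m i (Metric.closedBall (F i y) r) ∧
    m i (Metric.closedBall (F i y) r) ≤ C * lam (Metric.closedBall y r)

/-- A large-scale foliation of `(X, μ)` by `(Y, lam)` with base `Z`. The partition of `X` is given
by the map `proj : X → Z` sending a point to the index of its leaf; the leaves are measurable.
The leafwise measures, the normalizing factors and the large-scale equivalences are only
meaningful for `z` in the conull set `good`. -/
structure LargeScaleFoliation {X Y : Type*} [MetricSpace X] [MeasurableSpace X]
    [MetricSpace Y] [MeasurableSpace Y] (μ : Measure X) (lam : Measure Y)
    (Z : Type*) [MeasurableSpace Z] where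
  /-- the index of the leaf through a point -/
  proj : X → Z
  measurableSet_leaf : ∀ z, MeasurableSet (proj ⁻¹' {z})
  /-- the measure on the base -/
  ν : Measure Z
  /-- the indices of the leaves that carry the structure -/
  good : Set Z
  good_ae : ∀ᵐ z ∂ν, z ∈ good
  /-- the measure on the leaf `proj ⁻¹' {z}`, seen as a measure on `X` carried by that leaf -/
  leafMeasure : Z → Measure X
  leafMeasure_compl : ∀ z ∈ good, leafMeasure z (proj ⁻¹' {z})ᶜ = 0
  /-- measure decomposition: both iterated integrals exist and equal the integral over `X` -/
  decomposition : ∀ f : X → ℝ, Continuous f → HasCompactSupport f →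
    (∀ᵐ z ∂ν, Integrable f (leafMeasure z)) ∧
    Integrable (fun z => ∫ t, f t ∂(leafMeasure z)) ν ∧
    ∫ x, f x ∂μ = ∫ z, (∫ t, f t ∂(leafMeasure z)) ∂ν
  /-- the factors by which the leafwise measures are multiplied -/
  α : Z → ℝ≥0
  α_pos : ∀ z ∈ good, 0 < α z
  /-- the large-scale equivalences from `Y` onto the leaves -/
  equiv : Z → Y → X
  control : UniformLargeScaleEquiv lam good (fun z => proj ⁻¹' {z})
    (fun z => α z • leafMeasure z) equiv

namespace LargeScaleFoliation

/-- Measure normalization: the balls of radius `1` in `X` and in the leaves have volume between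
`C⁻¹` and `C`. -/
def IsNormal {X Y Z : Type*} [MetricSpace X] [MeasurableSpace X] [MetricSpace Y]
    [MeasurableSpace Y] [MeasurableSpace Z] {μ : Measure X} {lam : Measure Y}
    (F : LargeScaleFoliation μ lam Z) : Prop :=
  ∃ C : ℝ≥0, 1 ≤ C ∧
    (∀ x : X, (C : ℝ≥0∞)⁻¹ ≤ μ (Metric.closedBall x 1) ∧ μ (Metric.closedBall x 1) ≤ C) ∧
    ∀ z ∈ F.good, ∀ x : X, F.proj x = z →
      (C : ℝ≥0∞)⁻¹ ≤ F.leafMeasure z (Metric.closedBall x 1) ∧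
      F.leafMeasure z (Metric.closedBall x 1) ≤ C

/-- The compression of a large-scale foliation:
`ρ(t) = inf_z inf {d_X(h_z y, h_z y') : d_Y(y, y') ≥ t}`, which is `∞` if there are no such
pairs of points. -/
noncomputable def compression {X Y Z : Type*} [MetricSpace X] [MeasurableSpace X] [MetricSpace Y]
    [MeasurableSpace Y] [MeasurableSpace Z] {μ : Measure X} {lam : Measure Y}
    (F : LargeScaleFoliation μ lam Z) (t : ℝ) : ℝ≥0∞ :=
  ⨅ z ∈ F.good, ⨅ y : Y, ⨅ y' : Y, ⨅ _ : t ≤ dist y y', edist (F.equiv z y) (F.equiv z y')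

end LargeScaleFoliation

/-! A function `f` on `X` is tested leaf by leaf against functions on `Y`. Fix a measurable
projection `π` of `Y` onto a 1-separated net. On a good leaf, `discretize` pulls `f` back along `h_z
∘ π` to a function `u` on `Y`, setting it to zero where `f` vanishes somewhere in the unit ball
about `h_z (π y)`. In either case `u y` is a value of `f` within distance 1 of that point. Let `G`
be the oscillation of `f` at a fixed large scale of `X`. At corresponding points the gradient of `u`
is at most `G`, and `|f| ≤ |u| + G`. Coverings with bounded overlap turn this into `‖f‖ ≤ K‖u‖ +
‖G‖` and `‖|∇u|_h‖ ≤ K‖G‖` on the leaf, so an inequality with constant `J` for `u` gives `‖f‖ ≤ K(1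
+ J)‖G‖` (`exists_eLpNorm_leaf_le`). The factor `α_z` scales both sides alike and cancels.
Integrating over the leaves and using `G ≤ 2|∇f|_h'` gives the same on `X` (`exists_eLpNorm_le`).

The support of `u` must then be controlled. If `u y ≠ 0`, the whole unit ball about `h_z (π y)` lies
in the support of `f`. For a normal foliation these balls have mass bounded below and bounded
overlap, so there are `O(μ A)` of them and the support of `u` is covered by as many unit balls of
`Y`. For balls, two points of the support have net points with images at distance at most `2cρ(t) <
ρ(t)`, hence net points closer than `t`. This second argument needs no normalization.

Finally the additive 1 in `1 + J` is absorbed: the indicator of one ball of `Y` bounds `J` below by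
a positive constant, once the volume or radius is large. This is why (i) asks for `|Ω| ≥ v₀` unless
`φ 0 > 0`. -/

/-! ### Packing, nets and properness in locally doubling spaces. -/

namespace LocallyDoubling

variable {X : Type*} [MetricSpace X] [MeasurableSpace X] {μ : Measure X}

theorem exists_closedBall_two_pow_le (hd : LocallyDoubling μ) {r : ℝ} (hr : 0 < r) (n : ℕ) :
    ∃ C : ℝ≥0, ∀ x, μ (Metric.closedBall x (2 ^ n * r)) ≤ C * μ (Metric.closedBall x r) := by
  induction n with
  | zero => exact ⟨1, fun x => by simp⟩
  | succ n ih =>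
    obtain ⟨C, hC⟩ := ih
    obtain ⟨D, hD⟩ := hd (2 ^ n * r) (by positivity)
    refine ⟨D * C, fun x => ?_⟩
    have h1 := hD x
    rw [show 2 * (2 ^ n * r) = 2 ^ (n + 1) * r by ring] at h1
    calc _ ≤ _ := h1
      _ ≤ D * (C * μ (Metric.closedBall x r)) := by gcongr; exact hC x
      _ = _ := by push_cast; ring

theorem exists_closedBall_le (hd : LocallyDoubling μ) {r : ℝ} (hr : 0 < r) (R : ℝ) :
    ∃ C : ℝ≥0, ∀ x, μ (Metric.closedBall x R) ≤ C * μ (Metric.closedBall x r) := by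
  obtain ⟨n, hn⟩ := pow_unbounded_of_one_lt (R / r) (one_lt_two (α := ℝ))
  obtain ⟨C, hC⟩ := hd.exists_closedBall_two_pow_le hr n
  refine ⟨C, fun x => le_trans (measure_mono (Metric.closedBall_subset_closedBall ?_)) (hC x)⟩
  rw [div_lt_iff₀ hr] at hn
  exact hn.le

theorem closedBall_pos (hd : LocallyDoubling μ) (hμ : μ ≠ 0) {r : ℝ} (hr : 0 < r) (x : X) :
    0 < μ (Metric.closedBall x r) := by
  rw [pos_iff_ne_zero]
  intro h0
  apply hμ
  rw [← Measure.measure_univ_eq_zero, ← Metric.iUnion_closedBall_nat x, measure_iUnion_null_iff]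
  intro n
  obtain ⟨C, hC⟩ := hd.exists_closedBall_le hr n
  simpa [h0] using hC x

/-- Packing bound: the balls of radius `s / 2` about the separated points are disjoint inside `B(x,
R + s)`, and by doubling each carries a fixed fraction of the volume of that ball. -/
theorem exists_encard_le [OpensMeasurableSpace X] (hd : LocallyDoubling μ)
    (hfin : FiniteOnBounded μ) (hμ : μ ≠ 0) {s : ℝ} (hs : 0 < s) (R : ℝ) :
    ∃ M : ℕ, ∀ (x : X) (S : Set X), S ⊆ Metric.closedBall x R →
      S.Pairwise (fun y y' => s < dist y y') → S.encard ≤ M := by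
  obtain ⟨C, hC⟩ := hd.exists_closedBall_le (half_pos hs) (2 * R + s)
  refine ⟨⌈C⌉₊, fun x S hS hsep => ?_⟩
  by_contra! hlt
  obtain ⟨t, htS, ht⟩ := Set.exists_subset_encard_eq (Order.add_one_le_of_lt hlt)
  have htfin : t.Finite := Set.finite_of_encard_eq_coe (k := ⌈C⌉₊ + 1) (by simpa using ht)
  lift t to Finset X using htfin
  have hcard : t.card = ⌈C⌉₊ + 1 := by
    rw [Set.encard_coe_eq_coe_finsetCard] at ht
    exact_mod_cast ht
  have hR : 0 ≤ R := by
    obtain ⟨y, hy⟩ : t.Nonempty := by rw [← Finset.card_pos]; omega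
    -- Having a point forces `0 ≤ R`, which makes the radius `R + s` positive.
    have : dist y x ≤ R := hS (htS hy)
    exact dist_nonneg.trans this
  set V := μ (Metric.closedBall x (R + s)) with hV
  have hV0 : V ≠ 0 := (hd.closedBall_pos hμ (by linarith) x).ne'
  have hVt : V ≠ ∞ := (hfin _ Metric.isBounded_closedBall).ne
  have h1 : (t.card : ℝ≥0∞) * V ≤ C * V := by
    calc (t.card : ℝ≥0∞) * V = ∑ y ∈ t, V := by simp
      _ ≤ ∑ y ∈ t, C * μ (Metric.closedBall y (s / 2)) := by
        refine Finset.sum_le_sum fun y hy => (measure_mono ?_).trans (hC y)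
        apply Metric.closedBall_subset_closedBall'
        have : dist y x ≤ R := hS (htS hy)
        rw [dist_comm] at this
        linarith
      _ = C * μ (⋃ y ∈ t, Metric.closedBall y (s / 2)) := by
        rw [← Finset.mul_sum, measure_biUnion_finset]
        · intro y hy y' hy' hne
          apply Metric.closedBall_disjoint_closedBall
          linarith [hsep (htS hy) (htS hy') hne]
        · exact fun _ _ => Metric.isClosed_closedBall.measurableSet
      _ ≤ C * V := by
        gcongr
        refine measure_mono <| Set.iUnion₂_subset fun y hy =>
          Metric.closedBall_subset_closedBall' ?_
        have : dist y x ≤ R := hS (htS hy)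
        linarith
  rw [ENNReal.mul_le_mul_iff_left hV0 hVt, hcard] at h1
  have h2 : ((⌈C⌉₊ + 1 : ℕ) : ℝ≥0) ≤ C := by exact_mod_cast h1
  have h3 := Nat.le_ceil C
  push_cast at h2
  exact absurd (h2.trans h3) (by simp)

end LocallyDoubling

theorem exists_separated_net {X : Type*} [MetricSpace X] (A : Set X) (s : ℝ) (hs : 0 ≤ s) :
    ∃ N ⊆ A, N.Pairwise (fun y y' => s < dist y y') ∧ ∀ x ∈ A, ∃ y ∈ N, dist x y ≤ s := by
  obtain ⟨N, hN⟩ := zorn_subset {N : Set X | N ⊆ A ∧ N.Pairwise (fun y y' => s < dist y y')} (by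
    intro c hc hchain
    refine ⟨⋃₀ c, ⟨Set.sUnion_subset fun t ht => (hc ht).1, ?_⟩,
      fun t ht => Set.subset_sUnion_of_mem ht⟩
    exact (Set.pairwise_sUnion hchain.directedOn).2 fun t ht => (hc ht).2)
  refine ⟨N, hN.prop.1, hN.prop.2, fun x hx => ?_⟩
  by_contra! hfar
  have hins : insert x N ∈ {N : Set X | N ⊆ A ∧ N.Pairwise (fun y y' => s < dist y y')} := by
    refine ⟨Set.insert_subset hx hN.prop.1, ?_⟩
    rw [Set.pairwise_insert]
    exact ⟨hN.prop.2, fun y hy _ => ⟨hfar y hy, by rw [dist_comm]; exact hfar y hy⟩⟩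
  have hxN : x ∈ N := hN.le_of_ge hins (Set.subset_insert x N) (Set.mem_insert x N)
  have := hfar x hxN
  rw [dist_self] at this
  linarith

namespace LocallyDoubling

variable {X : Type*} [MetricSpace X] [MeasurableSpace X] [OpensMeasurableSpace X] {μ : Measure X}

theorem finite_of_separated (hd : LocallyDoubling μ) (hfin : FiniteOnBounded μ) (hμ : μ ≠ 0)
    {s : ℝ} (hs : 0 < s) {N : Set X} (hN : N.Pairwise (fun y y' => s < dist y y'))
    (hb : Bornology.IsBounded N) : N.Finite := by
  rcases N.eq_empty_or_nonempty with rfl | ⟨x, -⟩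
  · exact Set.finite_empty
  obtain ⟨R, hR⟩ := (Metric.isBounded_iff_subset_closedBall x).1 hb
  obtain ⟨M, hM⟩ := hd.exists_encard_le hfin hμ hs R
  exact Set.finite_of_encard_le_coe (hM x N hR hN)

theorem countable_of_separated (hd : LocallyDoubling μ) (hfin : FiniteOnBounded μ) (hμ : μ ≠ 0)
    {s : ℝ} (hs : 0 < s) {N : Set X} (hN : N.Pairwise (fun y y' => s < dist y y')) :
    N.Countable := by
  rcases N.eq_empty_or_nonempty with rfl | ⟨x, -⟩
  · exact Set.countable_empty
  have : N = ⋃ n : ℕ, N ∩ Metric.closedBall x n := by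
    rw [← Set.inter_iUnion, Metric.iUnion_closedBall_nat, Set.inter_univ]
  rw [this]
  exact Set.countable_iUnion fun n => (hd.finite_of_separated hfin hμ hs
    (hN.mono Set.inter_subset_left)
    (Metric.isBounded_closedBall.subset Set.inter_subset_right)).countable

theorem secondCountableTopology (hd : LocallyDoubling μ) (hfin : FiniteOnBounded μ) (hμ : μ ≠ 0) :
    SecondCountableTopology X := by
  refine Metric.secondCountable_of_almost_dense_set fun ε hε => ?_
  obtain ⟨N, -, hN, hcov⟩ := exists_separated_net (Set.univ : Set X) ε hε.le
  exact ⟨N, hd.countable_of_separated hfin hμ hε hN, fun x => hcov x trivial⟩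

theorem isCompact_closedBall [CompleteSpace X] (hd : LocallyDoubling μ) (hfin : FiniteOnBounded μ)
    (hμ : μ ≠ 0) (x : X) (r : ℝ) : IsCompact (Metric.closedBall x r) := by
  refine TotallyBounded.isCompact_of_isClosed ?_ Metric.isClosed_closedBall
  rw [Metric.totallyBounded_iff]
  intro ε hε
  obtain ⟨N, hNs, hN, hcov⟩ := exists_separated_net (Metric.closedBall x r) (ε / 2) (half_pos hε).le
  refine ⟨N, hd.finite_of_separated hfin hμ (half_pos hε) hN
    (Metric.isBounded_closedBall.subset hNs), fun y hy => ?_⟩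
  obtain ⟨z, hz, hyz⟩ := hcov y hy
  simp only [Set.mem_iUnion, Metric.mem_ball]
  exact ⟨z, hz, by linarith⟩

end LocallyDoubling

/-! ### Extending the disintegration from test functions to measurable functions. -/

/-- The integral of `g` against `μ` is the iterated integral of `g` against the family `κ`
over the base measure `ν`. -/
def DecomposesIntegral {X Z : Type*} [MeasurableSpace X] [MeasurableSpace Z] (μ : Measure X)
    (ν : Measure Z) (κ : Z → Measure X) (g : X → ℝ≥0∞) : Prop :=
  AEMeasurable (fun z => ∫⁻ x, g x ∂κ z) ν ∧ ∫⁻ z, ∫⁻ x, g x ∂κ z ∂ν = ∫⁻ x, g x ∂μ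

namespace DecomposesIntegral

variable {X Z : Type*} [MeasurableSpace X] [MeasurableSpace Z] {μ : Measure X}
  {ν : Measure Z} {κ : Z → Measure X}

theorem iSup {f : ℕ → X → ℝ≥0∞} (hf : ∀ n, Measurable (f n)) (hmono : Monotone f)
    (h : ∀ n, DecomposesIntegral μ ν κ (f n)) :
    DecomposesIntegral μ ν κ (fun x => ⨆ n, f n x) := by
  have h1 : (fun z => ∫⁻ x, ⨆ n, f n x ∂κ z) = fun z => ⨆ n, ∫⁻ x, f n x ∂κ z := by
    ext z
    exact lintegral_iSup hf hmono
  refine ⟨?_, ?_⟩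
  · rw [h1]
    exact AEMeasurable.iSup fun n => (h n).1
  · rw [h1, lintegral_iSup' (fun n => (h n).1) (Eventually.of_forall fun z m n hmn =>
      lintegral_mono (hmono hmn)), lintegral_iSup hf hmono]
    exact iSup_congr fun n => (h n).2

theorem add {f g : X → ℝ≥0∞} (hf : Measurable f) (h1 : DecomposesIntegral μ ν κ f)
    (h2 : DecomposesIntegral μ ν κ g) : DecomposesIntegral μ ν κ (f + g) := by
  have h : (fun z => ∫⁻ x, (f + g) x ∂κ z) = fun z => ∫⁻ x, f x ∂κ z + ∫⁻ x, g x ∂κ z := by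
    ext z
    exact lintegral_add_left hf g
  refine ⟨?_, ?_⟩
  · rw [h]
    exact h1.1.add h2.1
  · rw [h, lintegral_add_left' h1.1, h1.2, h2.2]
    exact (lintegral_add_left hf g).symm

theorem const_mul {g : X → ℝ≥0∞} (hg : Measurable g) (c : ℝ≥0∞) (h : DecomposesIntegral μ ν κ g) :
    DecomposesIntegral μ ν κ (fun x => c * g x) := by
  have h1 : (fun z => ∫⁻ x, c * g x ∂κ z) = fun z => c * ∫⁻ x, g x ∂κ z := by
    ext z
    exact lintegral_const_mul c hg
  refine ⟨?_, ?_⟩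
  · rw [h1]
    exact h.1.const_mul c
  · rw [h1, lintegral_const_mul'' c h.1, h.2, lintegral_const_mul c hg]

theorem tsum {f : ℕ → X → ℝ≥0∞} (hf : ∀ n, Measurable (f n))
    (h : ∀ n, DecomposesIntegral μ ν κ (f n)) :
    DecomposesIntegral μ ν κ (fun x => ∑' n, f n x) := by
  have h1 : (fun z => ∫⁻ x, ∑' n, f n x ∂κ z) = fun z => ∑' n, ∫⁻ x, f n x ∂κ z := by
    ext z
    exact lintegral_tsum fun n => (hf n).aemeasurable
  refine ⟨?_, ?_⟩
  · rw [h1]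
    exact AEMeasurable.tsum fun n => (h n).1
  · rw [h1, lintegral_tsum fun n => (h n).1, lintegral_tsum fun n => (hf n).aemeasurable]
    exact tsum_congr fun n => (h n).2

/-- Finiteness of the integral of `f` makes almost every fibre integral finite, so truncated
subtraction can be integrated fibrewise. It serves the complement step of the π-λ argument. -/
theorem sub {f g : X → ℝ≥0∞} (hg : Measurable g) (hle : g ≤ f)
    (hfin : ∫⁻ x, f x ∂μ ≠ ∞) (h1 : DecomposesIntegral μ ν κ f)
    (h2 : DecomposesIntegral μ ν κ g) : DecomposesIntegral μ ν κ (fun x => f x - g x) := by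
  have hf_ae : ∀ᵐ z ∂ν, ∫⁻ x, f x ∂κ z < ∞ := ae_lt_top' h1.1 (by rw [h1.2]; exact hfin)
  have h : (fun z => ∫⁻ x, f x - g x ∂κ z) =ᵐ[ν]
      fun z => ∫⁻ x, f x ∂κ z - ∫⁻ x, g x ∂κ z := by
    filter_upwards [hf_ae] with z hz
    exact lintegral_sub hg ((lintegral_mono hle).trans_lt hz).ne (Eventually.of_forall hle)
  have hgfin : ∫⁻ x, g x ∂μ ≠ ∞ := ((lintegral_mono hle).trans_lt hfin.lt_top).ne
  refine ⟨(h1.1.sub h2.1).congr h.symm, ?_⟩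
  rw [lintegral_congr_ae h, lintegral_sub' h2.1 (by rwa [h2.2])
    (Eventually.of_forall fun z => lintegral_mono hle), h1.2, h2.2,
    lintegral_sub hg hgfin (Eventually.of_forall hle)]

end DecomposesIntegral

section

variable {X Z : Type*} [MetricSpace X] [MeasurableSpace X] [BorelSpace X]
  [MeasurableSpace Z] {μ : Measure X} {ν : Measure Z} {κ : Z → Measure X}

theorem decomposesIntegral_of_isCompact_closure [IsFiniteMeasureOnCompacts μ]
    (hdec : ∀ f : X → ℝ, Continuous f → HasCompactSupport f →
      (∀ᵐ z ∂ν, Integrable f (κ z)) ∧ Integrable (fun z => ∫ t, f t ∂(κ z)) ν ∧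
      ∫ x, f x ∂μ = ∫ z, (∫ t, f t ∂(κ z)) ∂ν)
    {U : Set X} (hU : IsOpen U) (hc : IsCompact (closure U)) :
    DecomposesIntegral μ ν κ (U.indicator 1) := by
  -- Urysohn-type functions increasing to the indicator of `U`; the compact closure gives them
  -- compact support.
  let F : ℕ → X → ℝ≥0∞ := fun n x => min 1 (n * Metric.infEDist x Uᶜ)
  have hFtop : ∀ n x, F n x ≠ ∞ := fun n x => ((min_le_left _ _).trans_lt ENNReal.one_lt_top).ne
  have hFcont : ∀ n, Continuous (F n) := fun n =>
    continuous_const.min ((ENNReal.continuous_const_mul (ENNReal.natCast_ne_top n)).comp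
      Metric.continuous_infEDist)
  have hFsup : (fun x => ⨆ n, F n x) = U.indicator 1 := by
    ext x
    by_cases hx : x ∈ U
    · rw [Set.indicator_of_mem hx, Pi.one_apply]
      refine le_antisymm (iSup_le fun n => min_le_left _ _) ?_
      have hpos : Metric.infEDist x Uᶜ ≠ 0 := by
        intro h0
        rw [← Metric.mem_closure_iff_infEDist_zero, hU.isClosed_compl.closure_eq] at h0
        exact h0 hx
      obtain ⟨n, hn⟩ := ENNReal.exists_nat_mul_gt hpos ENNReal.one_ne_top
      exact le_iSup_of_le n (le_min le_rfl hn.le)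
    · have : Metric.infEDist x Uᶜ = 0 := Metric.infEDist_zero_of_mem hx
      simp [F, this, hx]
  rw [← hFsup]
  refine DecomposesIntegral.iSup (fun n => (hFcont n).measurable) ?_ fun n => ?_
  · intro m n hmn x
    exact min_le_min le_rfl (by gcongr)
  · have hreal : ∀ x, ENNReal.ofReal (F n x).toReal = F n x :=
      fun x => ENNReal.ofReal_toReal (hFtop n x)
    have hcont : Continuous fun x => (F n x).toReal :=
      ENNReal.continuousOn_toReal.comp_continuous (hFcont n) (hFtop n)
    have hsupp : HasCompactSupport fun x => (F n x).toReal := by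
      refine HasCompactSupport.of_support_subset_isCompact hc fun x hx => subset_closure ?_
      by_contra hxU
      have : Metric.infEDist x Uᶜ = 0 := Metric.infEDist_zero_of_mem hxU
      simp [F, this] at hx
    obtain ⟨h1, h2, h3⟩ := hdec _ hcont hsupp
    have h0 : ∀ x, 0 ≤ (F n x).toReal := fun x => ENNReal.toReal_nonneg
    have hz : (fun z => ∫⁻ x, F n x ∂κ z) =ᵐ[ν]
        fun z => ENNReal.ofReal (∫ x, (F n x).toReal ∂κ z) := by
      filter_upwards [h1] with z hz
      rw [ofReal_integral_eq_lintegral_ofReal hz (Eventually.of_forall h0)]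
      simp_rw [hreal]
    refine ⟨h2.1.aemeasurable.ennreal_ofReal.congr hz.symm, ?_⟩
    rw [lintegral_congr_ae hz, ← ofReal_integral_eq_lintegral_ofReal h2
      (Eventually.of_forall fun z => integral_nonneg h0), ← h3,
      ofReal_integral_eq_lintegral_ofReal (hcont.integrable_of_hasCompactSupport hsupp)
      (Eventually.of_forall h0)]
    simp_rw [hreal]

/-- Open sets are a π-system generating the Borel sets. The induction is run inside the relatively
compact sets `U n`, where complements can be subtracted without meeting `∞ - ∞`; the exhaustion and
simple functions do the rest. -/
theorem decomposesIntegral_of_continuous [LocallyCompactSpace X] [SecondCountableTopology X]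
    [IsFiniteMeasureOnCompacts μ]
    (hdec : ∀ f : X → ℝ, Continuous f → HasCompactSupport f →
      (∀ᵐ z ∂ν, Integrable f (κ z)) ∧ Integrable (fun z => ∫ t, f t ∂(κ z)) ν ∧
      ∫ x, f x ∂μ = ∫ z, (∫ t, f t ∂(κ z)) ∂ν)
    {g : X → ℝ≥0∞} (hg : Measurable g) : DecomposesIntegral μ ν κ g := by
  let K := CompactExhaustion.choice X
  let U : ℕ → Set X := fun n => interior (K n)
  have hUopen : ∀ n, IsOpen (U n) := fun n => isOpen_interior
  have hUsub : ∀ n, closure (U n) ⊆ K n := fun n =>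
    closure_minimal interior_subset (K.isCompact n).isClosed
  have hUmono : Monotone U := fun m n hmn => interior_mono (K.subset hmn)
  have hUcov : ∀ x, ∃ n, x ∈ U n := fun x => by
    obtain ⟨n, hn⟩ := K.exists_mem x
    exact ⟨n + 1, K.subset_interior_succ n hn⟩
  have hopen : ∀ n V, IsOpen V → DecomposesIntegral μ ν κ ((V ∩ U n).indicator 1) := fun n V hV =>
    decomposesIntegral_of_isCompact_closure hdec (hV.inter (hUopen n))
      ((K.isCompact n).of_isClosed_subset isClosed_closure
        ((closure_mono Set.inter_subset_right).trans (hUsub n)))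
  have hset : ∀ n A, MeasurableSet A → DecomposesIntegral μ ν κ ((A ∩ U n).indicator 1) := by
    intro n A hA
    refine MeasurableSpace.induction_on_inter
      (C := fun A _ => DecomposesIntegral μ ν κ ((A ∩ U n).indicator 1)) BorelSpace.measurable_eq
      isPiSystem_isOpen (by simpa using hopen n ∅ isOpen_empty) (fun V hV => hopen n V hV)
      ?_ ?_ A hA
    · intro A hA ih
      have huniv := hopen n Set.univ isOpen_univ
      rw [Set.univ_inter] at huniv
      have : (Aᶜ ∩ U n).indicator (1 : X → ℝ≥0∞) =
          fun x => (U n).indicator 1 x - (A ∩ U n).indicator 1 x := by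
        ext x
        by_cases h1 : x ∈ A <;> by_cases h2 : x ∈ U n <;> simp [h1, h2]
      rw [this]
      refine DecomposesIntegral.sub (measurable_one.indicator (hA.inter (hUopen n).measurableSet))
        (Set.indicator_le_indicator_of_subset Set.inter_subset_right (fun _ => zero_le)) ?_
        huniv ih
      rw [lintegral_indicator_one (hUopen n).measurableSet]
      exact ((measure_mono interior_subset).trans_lt (K.isCompact n).measure_lt_top).ne
    · intro A hdisj hA ih
      have : ((⋃ i, A i) ∩ U n).indicator (1 : X → ℝ≥0∞) =
          fun x => ∑' i, (A i ∩ U n).indicator 1 x := by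
        ext x
        by_cases hx : ∃ i, x ∈ A i ∩ U n
        · obtain ⟨i, hi⟩ := hx
          have hi' : x ∈ (⋃ i, A i) ∩ U n := ⟨Set.mem_iUnion_of_mem i hi.1, hi.2⟩
          rw [tsum_eq_single i, Set.indicator_of_mem hi, Set.indicator_of_mem hi']
          intro j hj
          exact Set.indicator_of_notMem
            (fun hxj => Set.disjoint_left.1 (hdisj hj) hxj.1 hi.1) _
        · have hx' : x ∉ (⋃ i, A i) ∩ U n := by
            rw [Set.iUnion_inter, Set.mem_iUnion]
            exact hx
          push Not at hx
          simp only [Set.indicator_of_notMem hx', Set.indicator_of_notMem (hx _), tsum_zero]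
      rw [this]
      exact DecomposesIntegral.tsum
        (fun i => measurable_one.indicator ((hA i).inter (hUopen n).measurableSet)) ih
  have hset' : ∀ A, MeasurableSet A → DecomposesIntegral μ ν κ (A.indicator 1) := by
    intro A hA
    have : A.indicator (1 : X → ℝ≥0∞) = fun x => ⨆ n, (A ∩ U n).indicator 1 x := by
      ext x
      refine le_antisymm ?_ (iSup_le fun n => Set.indicator_le_indicator_of_subset
        Set.inter_subset_left (fun _ => zero_le) x)
      by_cases hx : x ∈ A
      · obtain ⟨n, hn⟩ := hUcov x
        exact le_iSup_of_le n (by simp [hx, hn])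
      · simp [hx]
    rw [this]
    exact DecomposesIntegral.iSup
      (fun n => measurable_one.indicator (hA.inter (hUopen n).measurableSet))
      (fun m n hmn => Set.indicator_le_indicator_of_subset
        (Set.inter_subset_inter_right A (hUmono hmn)) (fun _ => zero_le)) fun n => hset n A hA
  refine Measurable.ennreal_induction (motive := DecomposesIntegral μ ν κ) ?_ ?_ ?_ hg
  · intro c s hs
    have h1 : s.indicator (fun _ => c) = fun x => c * s.indicator (1 : X → ℝ≥0∞) x := by
      ext x
      by_cases hx : x ∈ s <;> simp [hx]
    rw [h1]
    exact (hset' _ hs).const_mul (measurable_one.indicator hs) c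
  · exact fun f g _ hf _ h1 h2 => h1.add hf h2
  · exact fun f hf hmono h => DecomposesIntegral.iSup hf hmono h

end

/-! ### Bounded overlap and comparison of `L^p` norms. -/

/-- A countable family of measurable sets with overlap at most `M` satisfies
`∑ i, μ (W i ∩ ·) ≤ M μ`. -/
theorem sum_restrict_le_of_encard_le {X ι : Type*} [MeasurableSpace X] [Countable ι]
    (μ : Measure X) {W : ι → Set X} (hW : ∀ i, MeasurableSet (W i)) {M : ℕ}
    (hM : ∀ x, {i | x ∈ W i}.encard ≤ M) :
    Measure.sum (fun i => μ.restrict (W i)) ≤ (M : ℝ≥0∞) • μ := by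
  rw [Measure.le_iff]
  intro s hs
  rw [Measure.sum_apply _ hs]
  calc ∑' i, μ.restrict (W i) s = ∑' i, ∫⁻ x, (s ∩ W i).indicator 1 x ∂μ := by
        refine tsum_congr fun i => ?_
        rw [Measure.restrict_apply hs, lintegral_indicator_one (hs.inter (hW i))]
    _ = ∫⁻ x, ∑' i, (s ∩ W i).indicator 1 x ∂μ := by
        rw [lintegral_tsum]
        exact fun i => (measurable_one.indicator (hs.inter (hW i))).aemeasurable
    _ ≤ ∫⁻ x, M * s.indicator 1 x ∂μ := by
        refine lintegral_mono fun x => ?_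
        by_cases hx : x ∈ s
        · have h1 : ∀ i, (s ∩ W i).indicator (1 : X → ℝ≥0∞) x
              = {i | x ∈ W i}.indicator (fun _ => 1) i := by
            intro i
            by_cases h : x ∈ W i <;> simp [h, hx]
          simp only [h1, Set.indicator_of_mem hx, Pi.one_apply, mul_one]
          rw [← tsum_subtype, ENNReal.tsum_set_one]
          exact_mod_cast hM x
        · simp [hx]
    _ = ((M : ℝ≥0∞) • μ) s := by
        rw [lintegral_const_mul _ (measurable_one.indicator hs), lintegral_indicator_one hs]
        rfl

theorem tsum_setLIntegral_le_of_encard_le {X ι : Type*} [MeasurableSpace X] [Countable ι]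
    (μ : Measure X) {W : ι → Set X} (hW : ∀ i, MeasurableSet (W i)) {M : ℕ}
    (hM : ∀ x, {i | x ∈ W i}.encard ≤ M) (g : X → ℝ≥0∞) :
    ∑' i, ∫⁻ x in W i, g x ∂μ ≤ M * ∫⁻ x, g x ∂μ := by
  rw [← lintegral_sum_measure, ← smul_eq_mul, ← lintegral_smul_measure]
  exact lintegral_mono' (sum_restrict_le_of_encard_le μ hW hM) le_rfl

/-- If `φ y ≤ ψ x` whenever `y ∈ V i` and `x ∈ W i`, the sets `V i` cover, their measures are
controlled by those of the `W i`, and the `W i` have bounded overlap, then the `L^p` norm of `φ`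
is controlled by that of `ψ`. -/
theorem eLpNorm_le_of_le_on_cover {X Y ι : Type*} [MeasurableSpace X] [MeasurableSpace Y]
    [Countable ι] {m : Measure X} {lam : Measure Y} {W : ι → Set X} {V : ι → Set Y}
    (hW : ∀ i, MeasurableSet (W i)) (hV : ∀ i, MeasurableSet (V i)) {M : ℕ} (hM1 : 1 ≤ M)
    (hM : ∀ x, {i | x ∈ W i}.encard ≤ M) (hcov : ∀ᵐ y ∂lam, ∃ i, y ∈ V i)
    {C : ℝ≥0} (hC1 : 1 ≤ C) (hC : ∀ i, lam (V i) ≤ C * m (W i))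
    {φ : Y → ℝ≥0∞} {ψ : X → ℝ≥0∞} (hle : ∀ i, ∀ y ∈ V i, ∀ x ∈ W i, φ y ≤ ψ x)
    {p : ℝ≥0∞} (hp : 1 ≤ p) :
    eLpNorm φ p lam ≤ (C * M : ℝ≥0) * eLpNorm ψ p m := by
  have hCM : (1 : ℝ≥0∞) ≤ (C * M : ℝ≥0) := by
    have : (1 : ℝ≥0) ≤ M := by exact_mod_cast hM1
    exact_mod_cast one_le_mul hC1 this
  rcases eq_or_ne p ∞ with rfl | hptop
  · rw [eLpNorm_exponent_top, eLpNorm_exponent_top]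
    refine le_trans ?_ (le_mul_of_one_le_left zero_le hCM)
    have hnull : ∀ᵐ y ∂lam, ∀ i, lam (V i) = 0 → y ∉ V i := by
      rw [ae_all_iff]
      intro i
      by_cases h0 : lam (V i) = 0
      · filter_upwards [measure_eq_zero_iff_ae_notMem.1 h0] with y hy _ using hy
      · exact Eventually.of_forall fun y h => absurd h h0
    refine essSup_le_of_ae_le _ ?_
    filter_upwards [hcov, hnull] with y ⟨i, hi⟩ hn
    -- A piece `V i` of positive measure has a partner `W i` of positive measure, so some point of
    -- `W i` obeys the essential bound on `ψ`.
    have hmW : m (W i) ≠ 0 := by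
      intro h0
      refine hn i ?_ hi
      simpa [h0] using hC i
    obtain ⟨x, hx, hxle⟩ : ∃ x ∈ W i, ‖ψ x‖ₑ ≤ eLpNormEssSup ψ m := by
      by_contra! hcon
      apply hmW
      refine measure_mono_null (fun x hx => ?_)
        (ae_iff.1 (ae_le_essSup (f := fun x => ‖ψ x‖ₑ) (μ := m)))
      exact not_le.2 (hcon x hx)
    exact (hle i y hi x hx).trans hxle
  · have hp0 : p ≠ 0 := (zero_lt_one.trans_le hp).ne'
    have hq : 1 ≤ p.toReal := by
      rw [← ENNReal.toReal_one]
      exact ENNReal.toReal_mono hptop hp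
    have hq0 : 0 < p.toReal := zero_lt_one.trans_le hq
    rw [eLpNorm_eq_lintegral_rpow_enorm_toReal hp0 hptop,
      eLpNorm_eq_lintegral_rpow_enorm_toReal hp0 hptop]
    simp only [enorm_eq_self]
    have key : ∫⁻ y, φ y ^ p.toReal ∂lam ≤ (C * M : ℝ≥0) * ∫⁻ x, ψ x ^ p.toReal ∂m := by
      have hpiece : ∀ i, ∫⁻ y in V i, φ y ^ p.toReal ∂lam ≤
          C * ∫⁻ x in W i, ψ x ^ p.toReal ∂m := by
        intro i
        -- The constant `inf ψ ^ p` over `W i` separates the two integrals, so neither function has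
        -- to be measurable; this matters for `gradAt`.
        have h1 : ∀ y ∈ V i, φ y ^ p.toReal ≤ ⨅ x ∈ W i, ψ x ^ p.toReal := fun y hy =>
          le_iInf₂ fun x hx => ENNReal.rpow_le_rpow (hle i y hy x hx) hq0.le
        have h2 : ∀ x ∈ W i, (⨅ x ∈ W i, ψ x ^ p.toReal) ≤ ψ x ^ p.toReal := fun x hx =>
          iInf₂_le x hx
        calc ∫⁻ y in V i, φ y ^ p.toReal ∂lam
            ≤ ∫⁻ y in V i, (⨅ x ∈ W i, ψ x ^ p.toReal) ∂lam := setLIntegral_mono' (hV i) h1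
          _ = (⨅ x ∈ W i, ψ x ^ p.toReal) * lam (V i) := setLIntegral_const _ _
          _ ≤ (⨅ x ∈ W i, ψ x ^ p.toReal) * (C * m (W i)) := by gcongr; exact hC i
          _ = C * ∫⁻ x in W i, (⨅ x ∈ W i, ψ x ^ p.toReal) ∂m := by
            rw [setLIntegral_const]; ring
          _ ≤ _ := by gcongr 1; exact setLIntegral_mono' (hW i) h2
      have hcov' : lam = lam.restrict (⋃ i, V i) := by
        rw [Measure.restrict_eq_self_of_ae_mem]
        filter_upwards [hcov] with y hy
        exact Set.mem_iUnion.2 hy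
      calc ∫⁻ y, φ y ^ p.toReal ∂lam = ∫⁻ y in ⋃ i, V i, φ y ^ p.toReal ∂lam := by
            rw [← hcov']
        _ ≤ ∑' i, ∫⁻ y in V i, φ y ^ p.toReal ∂lam := lintegral_iUnion_le _ _
        _ ≤ ∑' i, C * ∫⁻ x in W i, ψ x ^ p.toReal ∂m := ENNReal.tsum_le_tsum hpiece
        _ = C * ∑' i, ∫⁻ x in W i, ψ x ^ p.toReal ∂m := ENNReal.tsum_mul_left
        _ ≤ C * (M * ∫⁻ x, ψ x ^ p.toReal ∂m) := by
            gcongr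
            exact tsum_setLIntegral_le_of_encard_le m hW hM _
        _ = _ := by push_cast; ring
    calc (∫⁻ y, φ y ^ p.toReal ∂lam) ^ (1 / p.toReal)
        ≤ ((C * M : ℝ≥0) * ∫⁻ x, ψ x ^ p.toReal ∂m) ^ (1 / p.toReal) :=
          ENNReal.rpow_le_rpow key (by positivity)
      _ = ((C * M : ℝ≥0) : ℝ≥0∞) ^ (1 / p.toReal) * (∫⁻ x, ψ x ^ p.toReal ∂m) ^ (1 / p.toReal) :=
          ENNReal.mul_rpow_of_nonneg _ _ (by positivity)
      _ ≤ _ := by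
          gcongr
          -- A constant at least 1 dominates its `p`-th root, which makes the bound independent of
          -- `p`.
          calc ((C * M : ℝ≥0) : ℝ≥0∞) ^ (1 / p.toReal) ≤ ((C * M : ℝ≥0) : ℝ≥0∞) ^ (1 : ℝ) :=
                ENNReal.rpow_le_rpow_of_exponent_le hCM ((div_le_one hq0).2 hq)
            _ = _ := ENNReal.rpow_one _

/-- An `L^p` inequality that holds uniformly on the pieces of a decomposition of `μ` holds
for `μ`. -/
theorem eLpNorm_le_of_ae_eLpNorm_le {X Z : Type*} [MeasurableSpace X] [MeasurableSpace Z]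
    {μ : Measure X} {ν : Measure Z} {κ : Z → Measure X}
    (hdec : ∀ g : X → ℝ≥0∞, Measurable g → DecomposesIntegral μ ν κ g)
    {φ ψ : X → ℝ≥0∞} (hφ : Measurable φ) (hψ : Measurable ψ) {p : ℝ≥0∞} (hp : p ≠ 0) {D : ℝ≥0}
    (h : ∀ᵐ z ∂ν, eLpNorm φ p (κ z) ≤ D * eLpNorm ψ p (κ z)) :
    eLpNorm φ p μ ≤ D * eLpNorm ψ p μ := by
  -- Null sets disintegrate into fibrewise null sets; this replaces integration when `p = ∞`.
  have hnull : ∀ A : Set X, MeasurableSet A → (μ A = 0 ↔ ∀ᵐ z ∂ν, κ z A = 0) := by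
    intro A hA
    have := hdec _ (measurable_one.indicator hA)
    simp only [DecomposesIntegral, lintegral_indicator_one hA] at this
    rw [← this.2, lintegral_eq_zero_iff' this.1]
    rfl
  rcases eq_or_ne p ∞ with rfl | hptop
  · simp only [eLpNorm_exponent_top] at h ⊢
    have h1 : ∀ᵐ x ∂μ, ‖ψ x‖ₑ ≤ eLpNormEssSup ψ μ := ae_le_essSup
    have hψE : ∀ᵐ z ∂ν, eLpNormEssSup ψ (κ z) ≤ eLpNormEssSup ψ μ := by
      have := (hnull {x | ¬ ψ x ≤ eLpNormEssSup ψ μ}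
        (measurableSet_le hψ measurable_const).compl).1 (ae_iff.1 h1)
      filter_upwards [this] with z hz
      exact essSup_le_of_ae_le _ (ae_iff.2 hz)
    refine essSup_le_of_ae_le _ (ae_iff.2 ?_)
    refine (hnull {x | ¬ φ x ≤ D * eLpNormEssSup ψ μ}
        (measurableSet_le hφ measurable_const).compl).2 ?_
    filter_upwards [h, hψE] with z hz hz'
    have h2 : ∀ᵐ x ∂κ z, ‖φ x‖ₑ ≤ eLpNormEssSup φ (κ z) := ae_le_essSup
    rw [← ae_iff]
    filter_upwards [h2] with x hx
    calc φ x ≤ eLpNormEssSup φ (κ z) := hx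
      _ ≤ D * eLpNormEssSup ψ (κ z) := hz
      _ ≤ _ := by gcongr
  · have hq0 : 0 < p.toReal := ENNReal.toReal_pos hp hptop
    simp only [one_div, eLpNorm_eq_lintegral_rpow_enorm_toReal hp hptop, enorm_eq_self] at h ⊢
    rw [ENNReal.rpow_inv_le_iff hq0, ENNReal.mul_rpow_of_nonneg _ _ hq0.le,
      ← ENNReal.rpow_mul, inv_mul_cancel₀ hq0.ne', ENNReal.rpow_one,
      ← (hdec _ (hφ.pow_const p.toReal)).2, ← (hdec _ (hψ.pow_const p.toReal)).2,
      ← lintegral_const_mul'' _ (hdec _ (hψ.pow_const p.toReal)).1]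
    refine lintegral_mono_ae ?_
    filter_upwards [h] with z hz
    rwa [ENNReal.rpow_inv_le_iff hq0, ENNReal.mul_rpow_of_nonneg _ _ hq0.le,
      ← ENNReal.rpow_mul, inv_mul_cancel₀ hq0.ne', ENNReal.rpow_one] at hz

/-! ### Gradients and their Borel substitute. -/

section

variable {X : Type*} [MetricSpace X]

theorem edist_le_gradAt {h : ℝ} (f : X → ℝ) {x y : X} (hxy : dist x y ≤ h) :
    edist (f y) (f x) ≤ gradAt h f x := by
  rw [edist_dist, Real.dist_eq]
  exact le_iSup₂_of_le y hxy le_rfl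

theorem gradAt_le {h : ℝ} {f : X → ℝ} {x : X} {a : ℝ≥0∞}
    (ha : ∀ y, dist x y ≤ h → edist (f y) (f x) ≤ a) : gradAt h f x ≤ a := by
  refine iSup₂_le fun y hy => ?_
  rw [← Real.dist_eq, ← edist_dist]
  exact ha y hy

/-- A Borel substitute for the gradient: the largest oscillation of `f` on the balls of radius
`R` about the points of `D` at distance at most `1`. -/
noncomputable def localOsc (D : Set X) (R : ℝ) (f : X → ℝ) (x : X) : ℝ≥0∞ :=
  ⨆ k ∈ D, (Metric.closedBall k 1).indicator (fun _ => Metric.ediam (f '' Metric.closedBall k R)) x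

theorem measurable_localOsc [MeasurableSpace X] [OpensMeasurableSpace X] {D : Set X}
    (hD : D.Countable) (R : ℝ) (f : X → ℝ) : Measurable (localOsc D R f) :=
  Measurable.biSup D hD fun _ _ =>
    measurable_const.indicator Metric.isClosed_closedBall.measurableSet

/-- The centre `k` is within 1 of `x`, which costs 1 in the radius. `localOsc_le` loses 1 for the
same reason, and a factor 2 by passing through `f x`. -/
theorem edist_le_localOsc {D : Set X} (hD : Dense D) {R : ℝ} (f : X → ℝ) {x a b : X}
    (ha : dist a x ≤ R - 1) (hb : dist b x ≤ R - 1) : edist (f a) (f b) ≤ localOsc D R f x := by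
  obtain ⟨k, hk, hkx⟩ := hD.exists_dist_lt x one_pos
  refine le_iSup₂_of_le k hk ?_
  rw [Set.indicator_of_mem (show x ∈ Metric.closedBall k 1 from hkx.le)]
  apply Metric.edist_le_ediam_of_mem <;> apply Set.mem_image_of_mem
  · exact (dist_triangle a x k).trans (by linarith)
  · exact (dist_triangle b x k).trans (by linarith)

theorem localOsc_le {D : Set X} {R h : ℝ} (hR : R + 1 ≤ h) (f : X → ℝ) (x : X) :
    localOsc D R f x ≤ 2 * gradAt h f x := by
  refine iSup₂_le fun k _ => ?_
  by_cases hx : x ∈ Metric.closedBall k 1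
  swap
  · simp [hx]
  rw [Set.indicator_of_mem hx]
  have hx' : dist x k ≤ 1 := hx
  refine Metric.ediam_le ?_
  rintro _ ⟨a, ha, rfl⟩ _ ⟨b, hb, rfl⟩
  have ha' : dist a k ≤ R := ha
  have hb' : dist b k ≤ R := hb
  have h1 : edist (f a) (f x) ≤ gradAt h f x :=
    edist_le_gradAt f ((dist_triangle_right x a k).trans (by linarith))
  have h2 : edist (f b) (f x) ≤ gradAt h f x :=
    edist_le_gradAt f ((dist_triangle_right x b k).trans (by linarith))
  rw [two_mul]
  exact (edist_triangle_right _ _ _).trans (add_le_add h1 h2)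

end

/-! ### Discretization along a net. -/

section

variable {X Y : Type*} [MetricSpace X]

open Classical in
/-- The function `f` transported along `e ∘ π`, and set to zero where `f` vanishes somewhere in
the unit ball. -/
noncomputable def discretize (e : Y → X) (π : Y → Y) (f : X → ℝ) (y : Y) : ℝ :=
  if ∃ x, dist x (e (π y)) ≤ 1 ∧ f x = 0 then 0 else f (e (π y))

theorem exists_discretize_eq (e : Y → X) (π : Y → Y) (f : X → ℝ) (y : Y) :
    ∃ a, dist a (e (π y)) ≤ 1 ∧ discretize e π f y = f a := by
  unfold discretize
  split_ifs with h
  · obtain ⟨x, hx, hfx⟩ := h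
    exact ⟨x, hx, hfx.symm⟩
  · exact ⟨e (π y), by simp, rfl⟩

theorem closedBall_subset_support_of_discretize_ne_zero {e : Y → X} {π : Y → Y} {f : X → ℝ} {y : Y}
    (h : discretize e π f y ≠ 0) : Metric.closedBall (e (π y)) 1 ⊆ Function.support f := by
  intro x hx hfx
  exact h (if_pos ⟨x, hx, hfx⟩)

/-- The function factors through `π`, whose range is countable, so no measurability of `e` is
involved. -/
theorem measurable_discretize [MeasurableSpace Y] [MeasurableSingletonClass Y] (e : Y → X)
    {π : Y → Y} (hπ : Measurable π) (hc : (Set.range π).Countable) (f : X → ℝ) :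
    Measurable (discretize e π f) := by
  let v : Y → ℝ := discretize e id f
  have hv : discretize e π f = v ∘ π := rfl
  rw [hv]
  intro s _
  have : v ∘ π ⁻¹' s = π ⁻¹' (Set.range π ∩ v ⁻¹' s) := by
    ext y
    simp
  rw [this]
  exact hπ (hc.mono Set.inter_subset_left).measurableSet

theorem discretize_mem_boundedSupportedIn [MeasurableSpace X] [MeasurableSpace Y]
    [MeasurableSingletonClass Y] (e : Y → X)
    {π : Y → Y} (hπ : Measurable π) (hc : (Set.range π).Countable) {f : X → ℝ} {A : Set X}
    (hf : f ∈ BoundedSupportedIn A) {B : Set Y} (hB : ∀ y, discretize e π f y ≠ 0 → y ∈ B) :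
    discretize e π f ∈ BoundedSupportedIn B := by
  obtain ⟨-, ⟨M, hM⟩, -⟩ := hf
  refine ⟨measurable_discretize e hπ hc f, ⟨M, fun y => ?_⟩, hB⟩
  obtain ⟨a, -, ha⟩ := exists_discretize_eq e π f y
  rw [ha]
  exact hM a

end

/-- A measurable projection of `Y` onto a countable `1`-separated net. -/
structure NetProjection {Y : Type*} [MetricSpace Y] [MeasurableSpace Y] (N : Set Y) (π : Y → Y) :
    Prop where
  countable : N.Countable
  separated : N.Pairwise fun y y' => 1 < dist y y'
  measurable : Measurable π
  mem : ∀ y, π y ∈ N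
  dist_le : ∀ y, dist y (π y) ≤ 1

namespace NetProjection

variable {Y : Type*} [MetricSpace Y] [MeasurableSpace Y] {N : Set Y} {π : Y → Y}

theorem countable_range (h : NetProjection N π) : (Set.range π).Countable :=
  h.countable.mono (Set.range_subset_iff.2 h.mem)

theorem exists_of_locallyDoubling [OpensMeasurableSpace Y] [Nonempty Y] {lam : Measure Y}
    (hd : LocallyDoubling lam) (hfin : FiniteOnBounded lam) (h0 : lam ≠ 0) :
    ∃ (N : Set Y) (π : Y → Y), NetProjection N π := by
  classical
  obtain ⟨N, -, hN, hcov⟩ := exists_separated_net (Set.univ : Set Y) 1 zero_le_one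
  have hcount := hd.countable_of_separated hfin h0 one_pos hN
  obtain ⟨y₀⟩ := ‹Nonempty Y›
  obtain ⟨y₁, hy₁, -⟩ := hcov y₀ trivial
  obtain ⟨e, he⟩ := hcount.exists_eq_range ⟨y₁, hy₁⟩
  have hex : ∀ y, ∃ n, dist y (e n) ≤ 1 := by
    intro y
    obtain ⟨x, hx, hyx⟩ := hcov y trivial
    rw [he] at hx
    obtain ⟨n, rfl⟩ := hx
    exact ⟨n, hyx⟩
  -- Taking the first net point within distance 1 in an enumeration makes the projection measurable.
  refine ⟨N, fun y => e (Nat.find (hex y)), hcount, hN, ?_, fun y => ?_, fun y =>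
    Nat.find_spec (hex y)⟩
  · exact (measurable_from_top (f := e)).comp (measurable_find hex fun k =>
      (Metric.isClosed_closedBall (x := e k) (ε := 1)).measurableSet)
  · rw [he]
    exact Set.mem_range_self _

end NetProjection

/-! ### The estimate on one leaf. -/

namespace LargeScaleFoliation

variable {X Y Z : Type*} [MetricSpace X] [MeasurableSpace X]
  [MetricSpace Y] [MeasurableSpace Y] [BorelSpace Y] [MeasurableSpace Z]
  {μ : Measure X} {lam : Measure Y}

/-- The balls about the images of the points of a net have bounded overlap. -/
theorem exists_encard_mem_closedBall_le (F : LargeScaleFoliation μ lam Z)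
    (hd : LocallyDoubling lam) (hfin : FiniteOnBounded lam) (h0 : lam ≠ 0) {N : Set Y}
    (hN : N.Pairwise fun y y' => 1 < dist y y') (r : ℝ) :
    ∃ M : ℕ, 1 ≤ M ∧ ∀ z ∈ F.good, ∀ x : X,
      {i : N | x ∈ Metric.closedBall (F.equiv z i) r}.encard ≤ M := by
  obtain ⟨R, hR⟩ := F.control.lower (2 * r)
  obtain ⟨M, hM⟩ := hd.exists_encard_le hfin h0 one_pos R
  -- The extra 1 secures `1 ≤ M`, needed to keep the constants above 1.
  refine ⟨M + 1, by omega, fun z hz x => ?_⟩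
  rw [← Subtype.val_injective.encard_image]
  rcases Set.eq_empty_or_nonempty {i : N | x ∈ Metric.closedBall (F.equiv z i) r} with he | ⟨i₀, hi₀⟩
  · rw [he]
    simp
  refine (hM i₀ _ ?_ (hN.mono ?_)).trans (by exact_mod_cast Nat.le_succ M)
  · rintro _ ⟨i, hi, rfl⟩
    apply hR z hz
    have h1 : dist x (F.equiv z i) ≤ r := hi
    have h2 : dist x (F.equiv z i₀) ≤ r := hi₀
    exact (dist_triangle_left _ _ x).trans (by linarith)
  · rintro _ ⟨i, -, rfl⟩
    exact i.2

/-- The key estimate on a single leaf. -/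
theorem exists_eLpNorm_leaf_le [BorelSpace X] (F : LargeScaleFoliation μ lam Z)
    (hd : LocallyDoubling lam) (hfin : FiniteOnBounded lam) (h0 : lam ≠ 0) {N : Set Y} {π : Y → Y}
    (hN : NetProjection N π) {D : Set X} (hD : Dense D) (hDc : D.Countable) (h : ℝ) :
    ∃ R : ℝ, 0 ≤ R ∧ ∃ K : ℝ≥0, ∀ z ∈ F.good, ∀ f : X → ℝ, Measurable f → ∀ p : ℝ≥0∞, 1 ≤ p →
      ∀ J : ℝ≥0, eLpNorm (discretize (F.equiv z) π f) p lam ≤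
          J * eLpNorm (gradAt h (discretize (F.equiv z) π f)) p lam →
        eLpNorm f p (F.leafMeasure z) ≤
          (K * (1 + J) : ℝ≥0) * eLpNorm (localOsc D R f) p (F.leafMeasure z) := by
  obtain ⟨C₀, hC₀⟩ := F.control.almostOnto
  obtain ⟨r₀, hr₀⟩ := F.control.volume
  obtain ⟨R₁, hR₁⟩ := F.control.upper 1
  obtain ⟨R₂, hR₂⟩ := F.control.upper (2 + |h|)
  -- `r₀` allows volume comparison, `C₀ + R₁` makes the balls about net images cover the leaf, and 1
  -- makes radius-`r` balls contain the unit balls `V i`.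
  set r : ℝ := max r₀ (max (C₀ + R₁) 1) with hr
  have hrr₀ : r₀ ≤ r := le_max_left _ _
  have hrC : C₀ + R₁ ≤ r := (le_max_left _ _).trans (le_max_right _ _)
  have hr1 : 1 ≤ r := (le_max_right _ _).trans (le_max_right _ _)
  obtain ⟨C, hC⟩ := hr₀ r hrr₀
  obtain ⟨C', hC'⟩ := hd.exists_closedBall_le one_pos r
  obtain ⟨M, hM1, hM⟩ := F.exists_encard_mem_closedBall_le hd hfin h0 hN.separated r
  obtain ⟨M', hM'⟩ := hd.exists_encard_le hfin h0 one_pos 2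
  have hNc : Countable N := hN.countable.to_subtype
  set K₁ : ℝ≥0 := max C 1 * M with hK₁
  set K₂ : ℝ≥0 := max (C * C') 1 * (M' + 1 : ℕ) with hK₂
  -- The path from a value point `a` of `u` to `x` has length at most `1 + R₂ + r ≤ R - 1`, the
  -- distance allowed by `edist_le_localOsc`.
  set R : ℝ := |R₂| + r + 2 with hR
  refine ⟨R, by positivity, K₂ * K₁ + 1, fun z hz f hf p hp J hJ => ?_⟩
  set m : Measure X := F.α z • F.leafMeasure z with hm
  set u := discretize (F.equiv z) π f with hu
  set G := localOsc D R f with hG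
  have hGm : Measurable G := measurable_localOsc hDc R f
  let W : N → Set X := fun i => Metric.closedBall (F.equiv z i) r
  let V : N → Set Y := fun i => Metric.closedBall (i : Y) 1
  have hW : ∀ i, MeasurableSet (W i) := fun i => Metric.isClosed_closedBall.measurableSet
  have hV : ∀ i, MeasurableSet (V i) := fun i => Metric.isClosed_closedBall.measurableSet
  have hMV : ∀ y, {i | y ∈ V i}.encard ≤ (M' + 1 : ℕ) := by
    intro y
    rw [← Subtype.val_injective.encard_image]
    refine (hM' y _ ?_ (hN.separated.mono ?_)).trans (by exact_mod_cast Nat.le_succ M')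
    · rintro _ ⟨i, hi, rfl⟩
      have : dist y i ≤ 1 := hi
      rw [Metric.mem_closedBall, dist_comm]
      linarith
    · rintro _ ⟨i, -, rfl⟩
      exact i.2
  have hVW : ∀ i, lam (V i) ≤ (max C 1 : ℝ≥0) * m (W i) := fun i =>
    calc lam (V i) ≤ lam (Metric.closedBall (i : Y) r) :=
          measure_mono (Metric.closedBall_subset_closedBall hr1)
      _ ≤ C * m (W i) := (hC z hz i).1
      _ ≤ _ := by gcongr; exact le_max_left _ _
  have hWV : ∀ i, m (W i) ≤ (max (C * C') 1 : ℝ≥0) * lam (V i) := fun i =>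
    calc m (W i) ≤ C * lam (Metric.closedBall (i : Y) r) := (hC z hz i).2
      _ ≤ C * (C' * lam (V i)) := by gcongr; exact hC' i
      _ = (C * C' : ℝ≥0) * lam (V i) := by push_cast; ring
      _ ≤ _ := by gcongr; exact le_max_left _ _
  have hcovV : ∀ᵐ y ∂lam, ∃ i, y ∈ V i :=
    Eventually.of_forall fun y => ⟨⟨π y, hN.mem y⟩, hN.dist_le y⟩
  have hcovW : ∀ᵐ x ∂m, ∃ i, x ∈ W i := by
    refine Measure.ae_smul_measure ?_ _
    have hleaf : ∀ᵐ x ∂(F.leafMeasure z), x ∈ F.proj ⁻¹' {z} := by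
      rw [ae_iff]
      exact F.leafMeasure_compl z hz
    filter_upwards [hleaf] with x hx
    obtain ⟨y, hy⟩ := hC₀ z hz x hx
    refine ⟨⟨π y, hN.mem y⟩, ?_⟩
    have h1 := hR₁ z hz y (π y) (hN.dist_le y)
    exact (dist_triangle _ _ _).trans ((add_le_add hy h1).trans hrC)
  have hclose : ∀ (i : N) (y : Y), dist y i ≤ 1 + |h| → ∀ x ∈ W i,
      ∃ a, dist a x ≤ R - 1 ∧ u y = f a := by
    intro i y hy x hx
    obtain ⟨a, ha, hua⟩ := exists_discretize_eq (F.equiv z) π f y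
    refine ⟨a, ?_, hua⟩
    have h1 : dist (F.equiv z (π y)) (F.equiv z i) ≤ R₂ := by
      apply hR₂ z hz
      have := hN.dist_le y
      rw [dist_comm] at this
      exact (dist_triangle _ y _).trans (by linarith)
    have h2 : dist x (F.equiv z i) ≤ r := hx
    have h3 := le_abs_self R₂
    have h4 : dist a x ≤ dist a (F.equiv z (π y)) + dist (F.equiv z (π y)) (F.equiv z i)
        + dist (F.equiv z i) x := dist_triangle4 _ _ _ _
    rw [dist_comm (F.equiv z i) x] at h4
    linarith
  have hgrad : eLpNorm (gradAt h u) p lam ≤ K₁ * eLpNorm G p m := by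
    refine eLpNorm_le_of_le_on_cover hW hV hM1 (hM z hz) hcovV (le_max_right _ _) hVW ?_ hp
    intro i y hy x hx
    have hy1 : dist y i ≤ 1 := hy
    refine gradAt_le fun y' hy' => ?_
    obtain ⟨a, ha, hua⟩ := hclose i y (hy1.trans (by linarith [abs_nonneg h])) x hx
    obtain ⟨b, hb, hub⟩ := hclose i y' (by
      rw [dist_comm] at hy'
      exact (dist_triangle y' y i).trans (by linarith [le_abs_self h])) x hx
    rw [hua, hub]
    exact edist_le_localOsc hD f hb ha
  -- The two covers exchange roles here; truncated subtraction expresses `|f| ≤ |u| + G` as a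
  -- comparison between points of `X` and of `Y`.
  have hdiff : eLpNorm (fun x => ‖f x‖ₑ - G x) p m ≤ K₂ * eLpNorm (fun y => ‖u y‖ₑ) p lam := by
    refine eLpNorm_le_of_le_on_cover hV hW (by omega) hMV hcovW (le_max_right _ _) hWV ?_ hp
    intro i x hx y hy
    have hy1 : dist y i ≤ 1 := hy
    obtain ⟨a, ha, hua⟩ := hclose i y (hy1.trans (by linarith [abs_nonneg h])) x hx
    rw [tsub_le_iff_right, hua]
    have h1 : edist (f x) (f a) ≤ G x := by
      refine edist_le_localOsc hD f ?_ ha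
      rw [dist_self]
      have := abs_nonneg R₂
      linarith
    rw [← edist_zero_right (f x), ← edist_zero_right (f a), add_comm]
    exact (edist_triangle _ (f a) _).trans (by gcongr)
  have hsum : eLpNorm f p m ≤ (((K₂ * K₁ + 1) * (1 + J) : ℝ≥0) : ℝ≥0∞) * eLpNorm G p m :=
    calc eLpNorm f p m ≤ eLpNorm ((fun x => ‖f x‖ₑ - G x) + G) p m := by
          refine eLpNorm_mono_enorm fun x => ?_
          rw [enorm_eq_self]
          exact le_tsub_add
      _ ≤ eLpNorm (fun x => ‖f x‖ₑ - G x) p m + eLpNorm G p m :=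
          eLpNorm_add_le (hf.enorm.sub hGm).aestronglyMeasurable hGm.aestronglyMeasurable hp
      _ ≤ K₂ * (J * (K₁ * eLpNorm G p m)) + eLpNorm G p m := by
          rw [eLpNorm_enorm] at hdiff
          gcongr
          refine hdiff.trans ?_
          gcongr
          exact hJ.trans (by gcongr)
      _ = ((K₂ * J * K₁ + 1 : ℝ≥0) : ℝ≥0∞) * eLpNorm G p m := by push_cast; ring
      _ ≤ _ := by
          gcongr
          calc K₂ * J * K₁ + 1 ≤ (K₂ * J * K₁ + 1) + (K₂ * K₁ + J) := le_self_add
            _ = _ := by ring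
  -- Rescaling the measure multiplies both norms by the same power of `α z`, which cancels; no
  -- uniform bound on `α` is needed.
  have hα : F.α z ≠ 0 := (F.α_pos z hz).ne'
  rw [hm, eLpNorm_smul_measure_of_ne_zero' hα, eLpNorm_smul_measure_of_ne_zero' hα] at hsum
  simp only [ENNReal.smul_def, smul_eq_mul] at hsum
  rw [mul_left_comm, ENNReal.mul_le_mul_iff_right] at hsum
  · exact hsum
  · simp [hα]
  · exact ENNReal.coe_ne_top

end LargeScaleFoliation

namespace FiniteOnBounded

theorem isFiniteMeasureOnCompacts {X : Type*} [MetricSpace X] [MeasurableSpace X] {μ : Measure X}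
    (h : FiniteOnBounded μ) : IsFiniteMeasureOnCompacts μ :=
  ⟨fun _ hK => h _ hK.isBounded⟩

end FiniteOnBounded

/-! ### From the leaves to the whole space, and the supports of discretizations. -/

namespace LargeScaleFoliation

variable {X Y Z : Type*} [MetricSpace X] [MeasurableSpace X]
  [MetricSpace Y] [MeasurableSpace Y] [MeasurableSpace Z]
  {μ : Measure X} {lam : Measure Y}

theorem decomposesIntegral [BorelSpace X] [LocallyCompactSpace X] (F : LargeScaleFoliation μ lam Z)
    (hμ : FiniteOnBounded μ) (hμd : LocallyDoubling μ) (hμ0 : μ ≠ 0)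
    {g : X → ℝ≥0∞} (hg : Measurable g) : DecomposesIntegral μ F.ν F.leafMeasure g := by
  have := hμd.secondCountableTopology hμ hμ0
  have := hμ.isFiniteMeasureOnCompacts
  exact decomposesIntegral_of_continuous F.decomposition hg

theorem leafMeasure_eq_zero_of_eq_zero (F : LargeScaleFoliation μ lam Z) (h0 : lam = 0) {z : Z}
    (hz : z ∈ F.good) : F.leafMeasure z = 0 := by
  rw [← Measure.measure_univ_eq_zero]
  rcases isEmpty_or_nonempty Y with hY | ⟨⟨y⟩⟩
  · obtain ⟨C₀, hC₀⟩ := F.control.almostOnto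
    have : (F.proj ⁻¹' {z})ᶜ = Set.univ := by
      rw [Set.compl_univ_iff, Set.eq_empty_iff_forall_notMem]
      intro x hx
      obtain ⟨y, -⟩ := hC₀ z hz x hx
      exact hY.false y
    rw [← this]
    exact F.leafMeasure_compl z hz
  · obtain ⟨r₀, hr₀⟩ := F.control.volume
    rw [← Metric.iUnion_closedBall_nat (F.equiv z y), measure_iUnion_null_iff]
    intro n
    obtain ⟨C, hC⟩ := hr₀ (max r₀ n) (le_max_left _ _)
    have h1 := (hC z hz y).2
    simp only [h0, Measure.coe_zero, Pi.zero_apply, mul_zero, Measure.smul_apply, nonpos_iff_eq_zero,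
      smul_eq_zero] at h1
    exact measure_mono_null (Metric.closedBall_subset_closedBall (le_max_right _ _))
      (h1.resolve_left (F.α_pos z hz).ne')

theorem ne_zero_and_good_nonempty [BorelSpace X] [LocallyCompactSpace X]
    (F : LargeScaleFoliation μ lam Z)
    (hμ : FiniteOnBounded μ) (hμd : LocallyDoubling μ) (hμ0 : μ ≠ 0) :
    lam ≠ 0 ∧ F.good.Nonempty := by
  have key : ¬ ∀ z ∈ F.good, F.leafMeasure z = 0 := by
    intro hzero
    apply hμ0
    rw [← Measure.measure_univ_eq_zero, ← lintegral_one,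
      ← (F.decomposesIntegral hμ hμd hμ0 (measurable_const (a := 1))).2]
    refine (lintegral_congr_ae (g := fun _ => 0) ?_).trans lintegral_zero
    filter_upwards [F.good_ae] with z hz
    simp [hzero z hz]
  refine ⟨fun h0 => key fun z hz => F.leafMeasure_eq_zero_of_eq_zero h0 hz, ?_⟩
  by_contra hne
  rw [Set.not_nonempty_iff_eq_empty] at hne
  exact key (by simp [hne])

/-- A Sobolev inequality for all discretizations of `f` implies one for `f`. -/
theorem exists_eLpNorm_le [BorelSpace X] [LocallyCompactSpace X] [BorelSpace Y]
    (F : LargeScaleFoliation μ lam Z)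
    (hμ : FiniteOnBounded μ) (hμd : LocallyDoubling μ) (hμ0 : μ ≠ 0)
    (hfin : FiniteOnBounded lam) (hd : LocallyDoubling lam) (h0 : lam ≠ 0)
    {N : Set Y} {π : Y → Y} (hN : NetProjection N π) (h : ℝ) :
    ∃ h₀ : ℝ, 0 < h₀ ∧ ∃ K : ℝ≥0, ∀ h' : ℝ, h₀ ≤ h' → ∀ p : ℝ≥0∞, 1 ≤ p →
      ∀ f : X → ℝ, Measurable f → ∀ J : ℝ≥0,
      (∀ z ∈ F.good, eLpNorm (discretize (F.equiv z) π f) p lam ≤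
          J * eLpNorm (gradAt h (discretize (F.equiv z) π f)) p lam) →
      eLpNorm f p μ ≤ (K * (1 + J) : ℝ≥0) * eLpNorm (gradAt h' f) p μ := by
  have := hμd.secondCountableTopology hμ hμ0
  obtain ⟨D, hDc, hD⟩ := TopologicalSpace.exists_countable_dense X
  obtain ⟨R, hR, K, hK⟩ := F.exists_eLpNorm_leaf_le hd hfin h0 hN hD hDc h
  refine ⟨R + 1, by linarith, K * 2, fun h' hh' p hp f hf J hJ => ?_⟩
  have hGm : Measurable (localOsc D R f) := measurable_localOsc hDc R f
  have h1 : eLpNorm (fun x => ‖f x‖ₑ) p μ ≤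
      (K * (1 + J) : ℝ≥0) * eLpNorm (localOsc D R f) p μ := by
    refine eLpNorm_le_of_ae_eLpNorm_le (fun g hg => F.decomposesIntegral hμ hμd hμ0 hg) hf.enorm
      hGm (zero_lt_one.trans_le hp).ne' ?_
    filter_upwards [F.good_ae] with z hz
    rw [eLpNorm_enorm]
    exact hK z hz f hf p hp J (hJ z hz)
  have h2 : eLpNorm (localOsc D R f) p μ ≤ (2 : ℝ≥0) • eLpNorm (gradAt h' f) p μ := by
    refine eLpNorm_le_nnreal_smul_eLpNorm_of_ae_le_mul' (Eventually.of_forall fun x => ?_) p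
    simpa using localOsc_le hh' f x
  rw [eLpNorm_enorm] at h1
  calc eLpNorm f p μ ≤ _ := h1
    _ ≤ (K * (1 + J) : ℝ≥0) * ((2 : ℝ≥0) • eLpNorm (gradAt h' f) p μ) := by gcongr
    _ = _ := by rw [ENNReal.smul_def, smul_eq_mul]; push_cast; ring

/-- For a normal foliation the unit balls of `Y` have bounded volume. -/
theorem exists_closedBall_one_le [BorelSpace X] (F : LargeScaleFoliation μ lam Z) (hF : F.IsNormal)
    (hμ : FiniteOnBounded μ) (hμd : LocallyDoubling μ) (hμ0 : μ ≠ 0) {z : Z} (hz : z ∈ F.good) :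
    ∃ Λ : ℝ≥0, ∀ y : Y, lam (Metric.closedBall y 1) ≤ Λ := by
  obtain ⟨C₁, -, -, hC₁⟩ := hF
  obtain ⟨r₀, hr₀⟩ := F.control.volume
  obtain ⟨C, hC⟩ := hr₀ (max r₀ 1) (le_max_left _ _)
  set r := max r₀ 1
  obtain ⟨M, hM⟩ := hμd.exists_encard_le hμ hμ0 one_pos r
  refine ⟨C * (F.α z * (M * C₁)), fun y => ?_⟩
  -- The net is taken inside the leaf, since normality bounds leafwise volumes only for balls
  -- centred on it.
  obtain ⟨N, hNs, hN, hcov⟩ := exists_separated_net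
    (Metric.closedBall (F.equiv z y) r ∩ F.proj ⁻¹' {z}) 1 zero_le_one
  have hNM := hM _ N (hNs.trans Set.inter_subset_left) hN
  have hNfin : N.Finite := Set.finite_of_encard_le_coe hNM
  lift N to Finset X using hNfin
  rw [Set.encard_coe_eq_coe_finsetCard] at hNM
  have hleaf : F.leafMeasure z (Metric.closedBall (F.equiv z y) r) ≤ M * C₁ :=
    calc F.leafMeasure z (Metric.closedBall (F.equiv z y) r)
        = F.leafMeasure z (Metric.closedBall (F.equiv z y) r ∩ F.proj ⁻¹' {z}) :=
          (measure_inter_conull (F.leafMeasure_compl z hz)).symm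
      _ ≤ F.leafMeasure z (⋃ k ∈ N, Metric.closedBall k 1) := by
          refine measure_mono fun x hx => ?_
          obtain ⟨k, hk, hxk⟩ := hcov x hx
          exact Set.mem_biUnion (s := (N : Set X)) hk hxk
      _ ≤ ∑ k ∈ N, F.leafMeasure z (Metric.closedBall k 1) := measure_biUnion_finset_le _ _
      _ ≤ ∑ k ∈ N, (C₁ : ℝ≥0∞) :=
          Finset.sum_le_sum fun k hk => (hC₁ z hz k (hNs hk).2).2
      _ = N.card * C₁ := by simp
      _ ≤ M * C₁ := by
          gcongr
          exact_mod_cast hNM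
  calc lam (Metric.closedBall y 1) ≤ lam (Metric.closedBall y r) :=
        measure_mono (Metric.closedBall_subset_closedBall (le_max_right _ _))
    _ ≤ C * (F.α z • F.leafMeasure z) (Metric.closedBall (F.equiv z y) r) := (hC z hz y).1
    _ = C * (F.α z * F.leafMeasure z (Metric.closedBall (F.equiv z y) r)) := rfl
    _ ≤ C * (F.α z * (M * C₁)) := by gcongr
    _ = _ := by push_cast; rfl

/-- For a normal foliation, discretizations of functions supported in `A` are supported in compact
sets of measure controlled by that of `A`. -/
theorem exists_isCompact_support_discretize [BorelSpace X] [LocallyCompactSpace X]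
    [BorelSpace Y] [CompleteSpace Y]
    (F : LargeScaleFoliation μ lam Z) (hF : F.IsNormal)
    (hμ : FiniteOnBounded μ) (hμd : LocallyDoubling μ) (hμ0 : μ ≠ 0)
    (hfin : FiniteOnBounded lam) (hd : LocallyDoubling lam)
    {N : Set Y} {π : Y → Y} (hN : NetProjection N π) :
    ∃ Λ : ℝ≥0, ∀ z ∈ F.good, ∀ (A : Set X), μ A ≠ ∞ → ∀ f : X → ℝ, Function.support f ⊆ A →
      ∃ B : Set Y, IsCompact B ∧ lam B ≤ Λ * μ A ∧
        ∀ y, discretize (F.equiv z) π f y ≠ 0 → y ∈ B := by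
  obtain ⟨h0, z₀, hz₀⟩ := F.ne_zero_and_good_nonempty hμ hμd hμ0
  -- The bound concerns `Y` alone, so a single leaf provides it for all of them.
  obtain ⟨Λ, hΛ⟩ := F.exists_closedBall_one_le hF hμ hμd hμ0 hz₀
  obtain ⟨C, hC1, hC, -⟩ := hF
  obtain ⟨M, -, hM⟩ := F.exists_encard_mem_closedBall_le hd hfin h0 hN.separated 1
  have hNc : Countable N := hN.countable.to_subtype
  have hC0 : (C : ℝ≥0∞) ≠ 0 := by
    have := zero_lt_one.trans_le hC1
    exact_mod_cast this.ne'
  refine ⟨C * M * Λ, fun z hz A hA f hf => ?_⟩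
  let W : N → Set X := fun i => Metric.closedBall (F.equiv z i) 1
  have hsum : ∑' i, μ.restrict A (W i) ≤ M * μ A := by
    have := tsum_setLIntegral_le_of_encard_le (μ.restrict A) (W := W)
      (fun i => Metric.isClosed_closedBall.measurableSet) (hM z hz) 1
    simpa using this
  have hsumtop : (M : ℝ≥0∞) * μ A ≠ ∞ := ENNReal.mul_ne_top (ENNReal.natCast_ne_top M) hA
  -- Markov's inequality for sums: at most `C * M * μ A` balls can have mass at least `C⁻¹` in `A`.
  obtain ⟨hI, hcard⟩ := ENNReal.finset_card_const_le_le_of_tsum_le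
    (c := M * μ A) hsumtop hsum (ε := (C : ℝ≥0∞)⁻¹) (by simp)
  refine ⟨⋃ i ∈ hI.toFinset, Metric.closedBall (i : Y) 1,
    hI.toFinset.isCompact_biUnion fun i _ => hd.isCompact_closedBall hfin h0 _ _, ?_, ?_⟩
  · calc lam (⋃ i ∈ hI.toFinset, Metric.closedBall (i : Y) 1)
        ≤ ∑ i ∈ hI.toFinset, lam (Metric.closedBall (i : Y) 1) := measure_biUnion_finset_le _ _
      _ ≤ ∑ i ∈ hI.toFinset, (Λ : ℝ≥0∞) := Finset.sum_le_sum fun i _ => hΛ i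
      _ = hI.toFinset.card * Λ := by simp
      _ ≤ (M * μ A / (C : ℝ≥0∞)⁻¹) * Λ := by gcongr
      _ = _ := by rw [div_eq_mul_inv, inv_inv]; push_cast; ring
  · intro y hy
    refine Set.mem_biUnion (s := (hI.toFinset : Set N)) (x := ⟨π y, hN.mem y⟩) ?_ (hN.dist_le y)
    have hsub : W ⟨π y, hN.mem y⟩ ⊆ A :=
      (closedBall_subset_support_of_discretize_ne_zero hy).trans hf
    rw [Set.Finite.coe_toFinset, Set.mem_ofPred_eq]
    rw [Measure.restrict_apply Metric.isClosed_closedBall.measurableSet,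
      Set.inter_eq_self_of_subset_left hsub]
    exact (hC _).1

/-- Discretizations of functions supported in a ball of radius below half the compression are
supported in balls. -/
theorem exists_support_discretize_subset_of_compression (F : LargeScaleFoliation μ lam Z)
    [Nonempty Y] {N : Set Y} {π : Y → Y} (hN : NetProjection N π) {c : ℝ≥0} (hc : c < 1 / 2) :
    ∀ᶠ t : ℝ in atTop, ∀ z ∈ F.good, ∀ x : X, ∀ f : X → ℝ,
      Function.support f ⊆ {x' | edist x' x ≤ c * F.compression t} →
      ∃ y₁ : Y, ∀ y, discretize (F.equiv z) π f y ≠ 0 → edist y y₁ ≤ ENNReal.ofReal (2 * t) := by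
  obtain ⟨R, hR⟩ := F.control.lower 1
  filter_upwards [eventually_gt_atTop R, eventually_ge_atTop 2] with t htR ht2
  intro z hz x f hf
  -- Positivity of `ρ(t)` makes `2cρ(t) < ρ(t)` strict; its finiteness below comes from the pair of
  -- points at hand.
  have hρ1 : 1 ≤ F.compression t := by
    refine le_iInf₂ fun z hz => le_iInf fun y => le_iInf fun y' => le_iInf fun hyy' => ?_
    by_contra! hlt
    refine absurd (hR z hz y y' ?_) (by linarith)
    rw [edist_dist, ← ENNReal.ofReal_one] at hlt
    exact (ENNReal.ofReal_lt_ofReal_iff'.1 hlt).1.le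
  by_cases hex : ∃ y₁, discretize (F.equiv z) π f y₁ ≠ 0
  swap
  · push Not at hex
    obtain ⟨y₀⟩ := ‹Nonempty Y›
    exact ⟨y₀, fun y hy => absurd (hex y) hy⟩
  obtain ⟨y₁, hy₁⟩ := hex
  have hmem : ∀ y, discretize (F.equiv z) π f y ≠ 0 →
      edist (F.equiv z (π y)) x ≤ c * F.compression t := fun y hy =>
    hf (closedBall_subset_support_of_discretize_ne_zero hy (Metric.mem_closedBall_self zero_le_one))
  refine ⟨y₁, fun y hy => ?_⟩
  have hlt : dist (π y) (π y₁) < t := by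
    by_contra! hge
    have h1 : F.compression t ≤ edist (F.equiv z (π y)) (F.equiv z (π y₁)) :=
      iInf₂_le_of_le z hz (iInf₂_le_of_le (π y) (π y₁) (iInf_le _ hge))
    have h2 : edist (F.equiv z (π y)) (F.equiv z (π y₁)) ≤
        c * F.compression t + c * F.compression t :=
      (edist_triangle_right _ _ x).trans (add_le_add (hmem y hy) (hmem y₁ hy₁))
    have htop : F.compression t ≠ ∞ := (h1.trans_lt (edist_lt_top _ _)).ne
    have h3 := h1.trans h2
    lift F.compression t to ℝ≥0 using htop with ρ
    have h4 : ρ ≤ c * ρ + c * ρ := by exact_mod_cast h3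
    have h5 : (1 : ℝ≥0) ≤ ρ := by exact_mod_cast hρ1
    have h6 : (ρ : ℝ) ≤ c * ρ + c * ρ := by exact_mod_cast h4
    have h7 : (1 : ℝ) ≤ ρ := by exact_mod_cast h5
    have h8 : (c : ℝ) < 1 / 2 := by exact_mod_cast hc
    nlinarith
  rw [edist_dist]
  apply ENNReal.ofReal_le_ofReal
  have h1 := hN.dist_le y
  have h2 := hN.dist_le y₁
  rw [dist_comm] at h2
  have h3 := dist_triangle4 y (π y) (π y₁) y₁
  linarith

end LargeScaleFoliation

/-! ### Test functions bounding the profiles from below. -/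

section

variable {X : Type*} [MetricSpace X] [MeasurableSpace X] {μ : Measure X}

/-- Indicators of balls are test functions with `‖|∇f|_h‖_p ≤ K ‖f‖_p`, uniformly in `p`. -/
theorem exists_eLpNorm_gradAt_indicator_le [OpensMeasurableSpace X]
    (hd : LocallyDoubling μ) (hfin : FiniteOnBounded μ) (h0 : μ ≠ 0) {h : ℝ} (hh : 0 < h) (x₀ : X) :
    ∃ K : ℝ≥0, 1 ≤ K ∧ ∀ p : ℝ≥0∞, 1 ≤ p →
      eLpNorm (gradAt h ((Metric.closedBall x₀ h).indicator 1)) p μ ≤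
        K * eLpNorm ((Metric.closedBall x₀ h).indicator (1 : X → ℝ)) p μ ∧
      eLpNorm ((Metric.closedBall x₀ h).indicator (1 : X → ℝ)) p μ ≠ 0 ∧
      eLpNorm ((Metric.closedBall x₀ h).indicator (1 : X → ℝ)) p μ ≠ ∞ := by
  obtain ⟨C, hC⟩ := hd.exists_closedBall_le hh (2 * h)
  refine ⟨max C 1, le_max_right _ _, fun p hp => ?_⟩
  set B := Metric.closedBall x₀ h with hB
  set B' := Metric.closedBall x₀ (2 * h) with hB'
  have hBpos : μ B ≠ 0 := (hd.closedBall_pos h0 hh x₀).ne'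
  have hBtop : μ B ≠ ∞ := (hfin _ Metric.isBounded_closedBall).ne
  have hB'pos : μ B' ≠ 0 := (hd.closedBall_pos h0 (by linarith) x₀).ne'
  have hp0 : p ≠ 0 := (zero_lt_one.trans_le hp).ne'
  have hq0 : 0 ≤ 1 / p.toReal := by positivity
  have hq1 : 1 / p.toReal ≤ 1 := by
    rcases eq_or_ne p ∞ with rfl | hptop
    · simp
    · have : 1 ≤ p.toReal := by
        rw [← ENNReal.toReal_one]
        exact ENNReal.toReal_mono hptop hp
      exact (div_le_one (by linarith)).2 this
  -- For `p = ∞` the exponent is `1 / 0 = 0` and the formula correctly gives 1.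
  have hnorm : eLpNorm (B.indicator (1 : X → ℝ)) p μ = μ B ^ (1 / p.toReal) := by
    have := eLpNorm_indicator_const' (c := (1 : ℝ))
      (Metric.isClosed_closedBall (x := x₀) (ε := h)).measurableSet hBpos hp0
    rwa [enorm_one, one_mul] at this
  have hnorm' : eLpNorm (B'.indicator (1 : X → ℝ)) p μ = μ B' ^ (1 / p.toReal) := by
    have := eLpNorm_indicator_const' (c := (1 : ℝ))
      (Metric.isClosed_closedBall (x := x₀) (ε := 2 * h)).measurableSet hB'pos hp0
    rwa [enorm_one, one_mul] at this
  -- The gradient of the indicator of `B(x₀, h)` lives on `B(x₀, 2h)`, whose volume doubling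
  -- controls.
  have hgrad : ∀ x, ‖gradAt h (B.indicator (1 : X → ℝ)) x‖ₑ ≤ ‖B'.indicator (1 : X → ℝ) x‖ₑ := by
    intro x
    rw [enorm_eq_self]
    refine gradAt_le fun y hy => ?_
    by_cases hx : x ∈ B'
    · by_cases h1 : x ∈ B <;> by_cases h2 : y ∈ B <;> simp [hx, h1, h2, edist_dist]
    · have h1 : x ∉ B := fun h1 =>
        hx (Metric.closedBall_subset_closedBall (by linarith) h1)
      have h2 : y ∉ B := fun h2 => by
        have h3 : dist y x₀ ≤ h := h2
        exact hx ((dist_triangle x y x₀).trans (by linarith))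
      simp [h1, h2]
  refine ⟨?_, ?_, ?_⟩
  · calc _ ≤ eLpNorm (B'.indicator (1 : X → ℝ)) p μ := eLpNorm_mono_enorm hgrad
      _ = μ B' ^ (1 / p.toReal) := hnorm'
      _ ≤ ((max C 1 : ℝ≥0) * μ B) ^ (1 / p.toReal) := by
        refine ENNReal.rpow_le_rpow ((hC x₀).trans ?_) hq0
        gcongr
        exact le_max_left _ _
      _ = ((max C 1 : ℝ≥0) : ℝ≥0∞) ^ (1 / p.toReal) * μ B ^ (1 / p.toReal) :=
        ENNReal.mul_rpow_of_nonneg _ _ hq0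
      _ ≤ ((max C 1 : ℝ≥0) : ℝ≥0∞) ^ (1 : ℝ) * μ B ^ (1 / p.toReal) := by
        gcongr
        exact_mod_cast le_max_right C 1
      _ = _ := by rw [ENNReal.rpow_one, hnorm]
  · rw [hnorm]
    exact (ENNReal.rpow_pos (pos_iff_ne_zero.2 hBpos) hBtop).ne'
  · rw [hnorm]
    exact ENNReal.rpow_ne_top_of_nonneg hq0 hBtop

theorem Jset_mono {h : ℝ} {p : ℝ≥0∞} {A B : Set X} (hAB : A ⊆ B) : Jset μ h p A ≤ Jset μ h p B :=
  biSup_mono fun _ hf => ⟨hf.1, hf.2.1, hf.2.2.trans hAB⟩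

theorem indicator_one_mem_boundedSupportedIn {X : Type*} [MeasurableSpace X] {B : Set X}
    (hB : MeasurableSet B) :
    B.indicator (1 : X → ℝ) ∈ BoundedSupportedIn B := by
  refine ⟨measurable_one.indicator hB, ⟨1, fun x => ?_⟩, Set.support_indicator_subset⟩
  by_cases hx : x ∈ B <;> simp [hx]

theorem exists_one_le_mul_Jset [OpensMeasurableSpace X]
    (hd : LocallyDoubling μ) (hfin : FiniteOnBounded μ) (h0 : μ ≠ 0) {h : ℝ} (hh : 0 < h) (x₀ : X) :
    ∃ K : ℝ≥0, ∀ p : ℝ≥0∞, 1 ≤ p → 1 ≤ K * Jset μ h p (Metric.closedBall x₀ h) := by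
  obtain ⟨K, hK1, hK⟩ := exists_eLpNorm_gradAt_indicator_le hd hfin h0 hh x₀
  refine ⟨K, fun p hp => ?_⟩
  obtain ⟨h1, h2, h3⟩ := hK p hp
  have hK0 : (K : ℝ≥0∞) ≠ 0 := by exact_mod_cast (zero_lt_one.trans_le hK1).ne'
  calc 1 ≤ K * eLpNorm ((Metric.closedBall x₀ h).indicator (1 : X → ℝ)) p μ /
        eLpNorm (gradAt h ((Metric.closedBall x₀ h).indicator 1)) p μ := by
        rw [ENNReal.le_div_iff_mul_le (Or.inr (mul_ne_zero hK0 h2))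
          (Or.inr (ENNReal.mul_ne_top ENNReal.coe_ne_top h3)), one_mul]
        exact h1
    _ ≤ _ := by
        rw [mul_div_assoc]
        gcongr
        exact le_iSup₂_of_le _
          (indicator_one_mem_boundedSupportedIn Metric.isClosed_closedBall.measurableSet) le_rfl

theorem exists_one_le_mul_of_sobolev [OpensMeasurableSpace X]
    (hd : LocallyDoubling μ) (hfin : FiniteOnBounded μ) (h0 : μ ≠ 0) {h : ℝ} (hh : 0 < h) (x₀ : X)
    {p : ℝ≥0∞} (hp : 1 ≤ p) {a : ℝ≥0}
    (ha : ∀ f ∈ BoundedSupportedIn (Metric.closedBall x₀ h),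
      eLpNorm f p μ ≤ a * eLpNorm (gradAt h f) p μ) :
    ∃ K : ℝ≥0, 1 ≤ K * a := by
  obtain ⟨K, -, hK⟩ := exists_eLpNorm_gradAt_indicator_le hd hfin h0 hh x₀
  obtain ⟨h1, h2, h3⟩ := hK p hp
  refine ⟨K, ?_⟩
  have h4 := ha _ (indicator_one_mem_boundedSupportedIn
    (Metric.isClosed_closedBall (x := x₀) (ε := h)).measurableSet)
  have h5 := h4.trans (mul_le_mul_right h1 (a : ℝ≥0∞))
  rw [← mul_assoc] at h5
  nth_rw 1 [← one_mul (eLpNorm _ p μ)] at h5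
  rw [ENNReal.mul_le_mul_iff_left h2 h3, mul_comm] at h5
  exact_mod_cast h5

/-- `j ≠ 0` matters when the gradient norm is `∞`: the quotient is then 0 and says nothing, while `0
* ∞ = 0`. -/
theorem eLpNorm_le_mul_of_Jset_le {h : ℝ} {p : ℝ≥0∞} {B : Set X} {j : ℝ≥0} (hj0 : j ≠ 0)
    (hj : Jset μ h p B ≤ j) {f : X → ℝ} (hf : f ∈ BoundedSupportedIn B) :
    eLpNorm f p μ ≤ j * eLpNorm (gradAt h f) p μ := by
  have h1 : eLpNorm f p μ / eLpNorm (gradAt h f) p μ ≤ j :=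
    (le_iSup₂ (f := fun f (_ : f ∈ BoundedSupportedIn B) =>
      eLpNorm f p μ / eLpNorm (gradAt h f) p μ) f hf).trans hj
  rwa [ENNReal.div_le_iff_le_mul (Or.inr ENNReal.coe_ne_top)
    (Or.inr (by exact_mod_cast hj0))] at h1

theorem AsympLE.of_eq_zero {f g : ℝ → ℝ≥0∞} (hf : ∀ t, f t = 0) : AsympLE f g :=
  ⟨1, one_pos, 0, Eventually.of_forall fun t => by simp [hf t]⟩

theorem Jset_zero_measure (h : ℝ) (p : ℝ≥0∞) (A : Set X) : Jset (0 : Measure X) h p A = 0 := by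
  simp [Jset]

theorem sobolevFrom_zero_measure (v₀ : ℝ≥0) (h : ℝ) (p : ℝ≥0∞) (φ : ℝ≥0 → ℝ≥0) :
    SobolevFrom (0 : Measure X) v₀ h p φ :=
  ⟨1, 1, one_pos, one_pos, fun _ _ _ _ _ => by simp⟩

end

/-! ### Absorbing the additive constant and assembling the theorem. -/

section

variable {X Y Z : Type*} [MetricSpace X] [MeasurableSpace X] [MetricSpace Y] [MeasurableSpace Y]
  [BorelSpace Y] {μ : Measure X} {lam : Measure Y}

theorem Jset_le_of_discretize {S : Set Z} {e : Z → Y → X} {N : Set Y} {π : Y → Y}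
    (hN : NetProjection N π) {h h' : ℝ} {p : ℝ≥0∞} {K K₀ : ℝ≥0} {j : ℝ≥0∞} (hj : 1 ≤ K₀ * j)
    (hK : ∀ f : X → ℝ, Measurable f → ∀ J : ℝ≥0,
      (∀ z ∈ S, eLpNorm (discretize (e z) π f) p lam ≤
          J * eLpNorm (gradAt h (discretize (e z) π f)) p lam) →
      eLpNorm f p μ ≤ (K * (1 + J) : ℝ≥0) * eLpNorm (gradAt h' f) p μ)
    {A : Set X} (hA : ∀ f ∈ BoundedSupportedIn A, ∀ z ∈ S, ∃ B : Set Y, Jset lam h p B ≤ j ∧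
      ∀ y, discretize (e z) π f y ≠ 0 → y ∈ B) :
    Jset μ h' p A ≤ (K * (K₀ + 1) + 1 : ℝ≥0) * j := by
  rcases eq_or_ne j ∞ with rfl | hjtop
  -- The summand 1 in the constant keeps it nonzero, so its product with `∞` is `∞`.
  · rw [ENNReal.mul_top (by simp)]
    exact le_top
  lift j to ℝ≥0 using hjtop
  have hj1 : 1 ≤ K₀ * j := by exact_mod_cast hj
  have hj0 : j ≠ 0 := by
    rintro rfl
    simp at hj1
  refine iSup₂_le fun f hf => ENNReal.div_le_of_le_mul ?_
  have h1 := hK f hf.1 j fun z hz => by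
    obtain ⟨B, hB, hsupp⟩ := hA f hf z hz
    exact eLpNorm_le_mul_of_Jset_le hj0 hB
      (discretize_mem_boundedSupportedIn _ hN.measurable hN.countable_range hf hsupp)
  refine h1.trans ?_
  gcongr
  rw [← ENNReal.coe_mul, ENNReal.coe_le_coe]
  calc K * (1 + j) ≤ K * (K₀ * j + j) := by gcongr
    _ ≤ K * (K₀ * j + j) + j := le_self_add
    _ = _ := by ring

/-- `hE` bounds 1 by a multiple of `φ`, which absorbs the 1 of `1 + J`; `E'` and `C' * Λ` are added
so that monotonicity brings both values of `φ` to one argument. -/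
theorem SobolevFrom.of_discretize {S : Set Z} {e : Z → Y → X} {N : Set Y} {π : Y → Y}
    (hN : NetProjection N π) (hμ : FiniteOnBounded μ) {h h' : ℝ} {p : ℝ≥0∞} {K Λ : ℝ≥0}
    (hK : ∀ f : X → ℝ, Measurable f → ∀ J : ℝ≥0,
      (∀ z ∈ S, eLpNorm (discretize (e z) π f) p lam ≤
          J * eLpNorm (gradAt h (discretize (e z) π f)) p lam) →
      eLpNorm f p μ ≤ (K * (1 + J) : ℝ≥0) * eLpNorm (gradAt h' f) p μ)
    (hΛ : ∀ z ∈ S, ∀ (A : Set X), μ A ≠ ∞ → ∀ f : X → ℝ, Function.support f ⊆ A →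
      ∃ B : Set Y, IsCompact B ∧ lam B ≤ Λ * μ A ∧ ∀ y, discretize (e z) π f y ≠ 0 → y ∈ B)
    {φ : ℝ≥0 → ℝ≥0} (hφ : Monotone φ) (hY : Sobolev lam h p φ) {v₀ E E' : ℝ≥0}
    (hE : ∀ v, v₀ ≤ v → 1 ≤ E * φ (E' * v)) :
    SobolevFrom μ v₀ h' p φ := by
  obtain ⟨C, C', hC, hC', hS⟩ := hY
  refine ⟨K * (E + C) + 1, E' + C' * Λ + 1, by positivity, by positivity, fun Ω hΩ hv f hf => ?_⟩
  have hΩtop : μ Ω ≠ ∞ := (hμ _ hΩ.isBounded).ne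
  set v := (μ Ω).toNNReal with hvdef
  have hvΩ : (v : ℝ≥0∞) = μ Ω := ENNReal.coe_toNNReal hΩtop
  have hv' : v₀ ≤ v := by rwa [← hvΩ, ENNReal.coe_le_coe] at hv
  have h1 := hK f hf.1 (C * φ (C' * (Λ * v))) fun z hz => by
    obtain ⟨B, hBc, hB, hsupp⟩ := hΛ z hz Ω hΩtop f hf.2.2
    rw [← hvΩ, ← ENNReal.coe_mul] at hB
    have hB' : (lam B).toNNReal ≤ Λ * v := by
      simpa using ENNReal.toNNReal_mono ENNReal.coe_ne_top hB
    refine (hS B hBc (by simp) _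
      (discretize_mem_boundedSupportedIn _ hN.measurable hN.countable_range hf hsupp)).trans ?_
    push_cast
    gcongr
    exact hφ (by gcongr)
  refine h1.trans ?_
  gcongr
  rw [← ENNReal.coe_mul, ENNReal.coe_le_coe]
  have h2 : φ (E' * v) ≤ φ ((E' + C' * Λ + 1) * v) := by
    apply hφ
    gcongr
    exact le_self_add.trans le_self_add
  have h3 : φ (C' * (Λ * v)) ≤ φ ((E' + C' * Λ + 1) * v) := by
    apply hφ
    rw [← mul_assoc]
    gcongr
    exact le_add_self.trans le_self_add
  calc K * (1 + C * φ (C' * (Λ * v)))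
      ≤ K * (E * φ ((E' + C' * Λ + 1) * v) + C * φ ((E' + C' * Λ + 1) * v)) := by
        gcongr
        exact (hE v hv').trans (by gcongr)
    _ ≤ K * (E * φ ((E' + C' * Λ + 1) * v) + C * φ ((E' + C' * Λ + 1) * v)) +
        φ ((E' + C' * Λ + 1) * v) := le_self_add
    _ = _ := by ring

end

theorem mainTheorem4 {X Y Z : Type*}
    [MetricSpace X] [MeasurableSpace X] [BorelSpace X] [LocallyCompactSpace X]
    [MetricSpace Y] [MeasurableSpace Y] [BorelSpace Y] [CompleteSpace Y]
    [MeasurableSpace Z]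
    (μ : Measure X) (hμ : FiniteOnBounded μ) (hμd : LocallyDoubling μ)
    (lam : Measure Y) (hlam : FiniteOnBounded lam) (hlamd : LocallyDoubling lam)
    (F : LargeScaleFoliation μ lam Z) (h : ℝ) (hh : 0 < h) :
    ∃ h₀ : ℝ, 0 < h₀ ∧ ∀ h' : ℝ, h₀ ≤ h' → ∀ p : ℝ≥0∞, 1 ≤ p →
      (F.IsNormal →
        (∀ φ : ℝ≥0 → ℝ≥0, Monotone φ → Sobolev lam h p φ →
          (∀ v₀ : ℝ≥0, 0 < v₀ → SobolevFrom μ v₀ h' p φ) ∧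
          (0 < φ 0 → Sobolev μ h' p φ)) ∧
        AsympLE (isoProfile μ h' p) (isoProfile lam h p)) ∧
      (∀ c : ℝ≥0, 0 < c → c < 1 / 2 →
        AsympLE (fun t => isoProfileBalls μ h' p (c * F.compression t))
          (fun t => isoProfileBalls lam h p (ENNReal.ofReal t))) := by
  -- The packing bounds need a nonzero measure; for `μ = 0` all norms vanish.
  rcases eq_or_ne μ 0 with rfl | hμ0
  · refine ⟨1, one_pos, fun h' _ p _ => ⟨fun _ => ⟨fun φ _ _ => ⟨fun v₀ _ =>
      sobolevFrom_zero_measure _ _ _ _, fun _ => sobolevFrom_zero_measure _ _ _ _⟩,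
      AsympLE.of_eq_zero fun v => ?_⟩, fun c _ _ => AsympLE.of_eq_zero fun t => ?_⟩⟩
    · simp [isoProfile, Jset_zero_measure]
    · simp [isoProfileBalls, Jset_zero_measure]
  obtain ⟨h0, -⟩ := F.ne_zero_and_good_nonempty hμ hμd hμ0
  have hYne : Nonempty Y := by
    by_contra hne
    rw [not_nonempty_iff] at hne
    exact h0 (Measure.eq_zero_of_isEmpty lam)
  obtain ⟨y₀⟩ := id hYne
  obtain ⟨N, π, hN⟩ := NetProjection.exists_of_locallyDoubling hlamd hlam h0
  obtain ⟨h₀, hh₀, K, hK⟩ := F.exists_eLpNorm_le hμ hμd hμ0 hlam hlamd h0 hN h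
  obtain ⟨K₀, hK₀⟩ := exists_one_le_mul_Jset hlamd hlam h0 hh y₀
  refine ⟨h₀, hh₀, fun h' hh' p hp => ⟨fun hF => ?_, fun c _ hc => ?_⟩⟩
  · obtain ⟨Λ, hΛ⟩ := F.exists_isCompact_support_discretize hF hμ hμd hμ0 hlam hlamd hN
    refine ⟨fun φ hφ hY => ⟨fun v₀ hv₀ => ?_, fun hφ0 => ?_⟩, ?_⟩
    · obtain ⟨C, C', hC, hC', hS⟩ := id hY
      set b := (lam (Metric.closedBall y₀ h)).toNNReal with hb
      obtain ⟨K₁, hK₁⟩ := exists_one_le_mul_of_sobolev hlamd hlam h0 hh y₀ hp (a := C * φ (C' * b))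
        fun f hf => by
          simpa using hS _ (hlamd.isCompact_closedBall hlam h0 y₀ h) (by simp) f hf
      -- `E' * v ≥ C' * b` exactly when `v ≥ v₀` suffices to reach the volume `b` of the test ball.
      refine SobolevFrom.of_discretize hN hμ (hK h' hh' p hp) hΛ hφ hY (E := K₁ * C)
        (E' := C' * b / v₀) fun v hv => ?_
      rw [← mul_assoc] at hK₁
      refine hK₁.trans ?_
      gcongr
      apply hφ
      rw [div_mul_eq_mul_div, le_div_iff₀ hv₀]
      gcongr
    · refine SobolevFrom.of_discretize hN hμ (hK h' hh' p hp) hΛ hφ hY (E := (φ 0)⁻¹)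
        (E' := 1) fun v _ => ?_
      rw [← div_eq_inv_mul, le_div_iff₀ hφ0, one_mul]
      exact hφ zero_le
    · have hΛ1 : (0 : ℝ) < max (Λ : ℝ) 1 := lt_max_of_lt_right one_pos
      refine ⟨max Λ 1, hΛ1, K * (K₀ + 1) + 1, ?_⟩
      -- From this volume on, the test ball competes in the profile of `Y`.
      filter_upwards [eventually_ge_atTop (lam (Metric.closedBall y₀ h)).toReal,
        eventually_ge_atTop 0] with v hv hv0
      have hset : ∀ B : Set Y, MeasurableSet B → lam B ≤ ENNReal.ofReal (max (Λ : ℝ) 1 * v) →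
          Jset lam h p B ≤ isoProfile lam h p (max (Λ : ℝ) 1 * v) := fun B hB hBv =>
        le_iSup₂_of_le B ⟨hB, hBv⟩ le_rfl
      refine iSup₂_le fun A hA => ?_
      refine Jset_le_of_discretize hN ((hK₀ p hp).trans ?_) (hK h' hh' p hp) fun f hf z hz => ?_
      · gcongr
        refine hset _ Metric.isClosed_closedBall.measurableSet ?_
        rw [← ENNReal.ofReal_toReal (hlam _ Metric.isBounded_closedBall).ne]
        refine ENNReal.ofReal_le_ofReal (hv.trans ?_)
        exact le_mul_of_one_le_left hv0 (le_max_right _ _)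
      · obtain ⟨B, hBc, hB, hsupp⟩ := hΛ z hz A (hA.2.trans_lt ENNReal.ofReal_lt_top).ne f hf.2.2
        refine ⟨B, hset B hBc.measurableSet (hB.trans ?_), hsupp⟩
        rw [ENNReal.ofReal_mul hΛ1.le]
        gcongr
        · rw [← ENNReal.ofReal_coe_nnreal]
          exact ENNReal.ofReal_le_ofReal (le_max_left _ _)
        · exact hA.2
  -- The net points are closer than `t`, and the two projections add at most `2 ≤ t`, whence radius
  -- `2 * t`.
  · refine ⟨2, two_pos, K * (K₀ + 1) + 1, ?_⟩
    filter_upwards [F.exists_support_discretize_subset_of_compression hN hc,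
      eventually_ge_atTop h] with t ht hth
    refine iSup_le fun x => ?_
    refine Jset_le_of_discretize hN ((hK₀ p hp).trans ?_) (hK h' hh' p hp) fun f hf z hz => ?_
    · gcongr
      refine le_iSup_of_le y₀ (Jset_mono fun y hy => ?_)
      have hy' : dist y y₀ ≤ h := hy
      rw [Set.mem_ofPred_eq, edist_dist]
      exact ENNReal.ofReal_le_ofReal (by linarith)
    · obtain ⟨y₁, hy₁⟩ := ht z hz x f hf.2.2
      exact ⟨_, le_iSup (fun y => Jset lam h p {y' | edist y' y ≤ ENNReal.ofReal (2 * t)}) y₁, hy₁⟩
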